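/- Let $\mathbb D$ be an equipment (framed bicategory): a pseudo double category in which every restriction $Q(g,f)$ exists, i.e. for all vertical arrows $f\colon a\to c$, $g\colon b\to d$ and every proarrow $Q\colon c\nrightarrow d$ there is a cartesian cell $Q(g,f)\Rightarrow Q$ with left frame $f$ and right frame $g$. Write $\odot$ for composition of proarrows in diagrammatic order and $U_x$ for the unit proarrow of $x$. A proarrow $P\colon c\nrightarrow d$ is represented by $f\colon c\to d$ if it comes with a cartesian cell $P\Rightarrow U_d$ with frames $(f,1_d)$; write $P\cong d(1,f)$. Dually $d(f,1)\colon d\nrightarrow c$. Definitions. A monoid $M\colon c\nrightarrow c$ is a monad in the horizontal bicategory $\mathcal H(\mathbb D)$; bimodules are defined likewise. An embedding $(f,\vec f)$ of $M$ into $x$ is a vertical arrow $f\colon c\to x$ with a cell $\vec f\colon M\Rightarrow U_x$, both frames $f$, respecting units and multiplications. An embedding of an $(M,N)$-bimodule $B$ into $P\colon x\nrightarrow y$ along embeddings $f\colon M\to x$, $g\colon N\to y$ is a cell $B\Rightarrow P$ with frames $f,g$ respecting both actions. A collapse of $M$ is an embedding $(i,\vec\imath)$ of $M$ through which every embedding factors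 as $(h\circ i,h\circ\vec\imath)$ for a unique vertical arrow $h$; a collapse of $B$ is an embedding of $B$ along collapses of $M$ and $N$ through which every embedding of $B$ factors uniquely. A collapse of $M$ is normal if $\vec\imath$ is also a collapse of the unit bimodule ${}_MM_M$. An embedding $(f,\vec f)$ with $\vec f$ cartesian exhibits $M$ as the kernel $\ker f$. A monoid is effective if it is a kernel; a bimodule is effective if it has an embedding $\phi$, along some $(f,\vec f)$ and $(g,\vec g)$, with $\vec f,\vec g,\phi$ all cartesian. A vertical arrow $f$ is a regular cover if $\ker f\Rightarrow U$ is a normal collapse. $\mathbb D$ is exact if 1. every effective monoid has a normal collapse; 2. for every proarrow $B\colon d\nrightarrow d'$ and all regular covers $f\colon c\to d$, $g\colon c'\to d'$, the cartesian embedding of the $(\ker f,\ker g)$-bimodule $B(g,f)$ into $B$ is a bimodule collapse; 3. every monoid and every bimodule in $\mathbb D$ is effective. $\mathbb D$ satisfies Wood's axiom 5 if for every monoid $M\colon c\nrightarrow c$ there are an object $c_M$, a vertical arrow $i\colon c\to c_M$ and a cell $\vec\imath\colon M\Rightarrow U_{c_M}$ with both frames $i$ such that 1. the corresponding cell $M\odot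 c_M(1,i)\Rightarrow c_M(1,i)$ makes $c_M(1,i)$ a universal left $M$-module: for every $b$, the functor $Y\mapsto c_M(1,i)\odot Y$ from $\mathcal H(\mathbb D)(c_M,b)$ to the category of left $M$-modules $c\nrightarrow b$ is an equivalence ($c_M$ is a Kleisli object); 2. the corresponding cell $c_M(i,1)\odot M\Rightarrow c_M(i,1)$ makes $c_M(i,1)$ a universal right $M$-module, in the dual sense ($c_M$ is an Eilenberg–Moore object); 3. a proarrow $P\colon c_M\nrightarrow d$ is representable if and only if $c_M(1,i)\odot P$ is. Moreover, if a cartesian cell $\xi\colon c_M(1,i)\odot P\Rightarrow U_d$ represents the latter by $g\colon c\to d$, then there is a unique $f\colon c_M\to d$ such that $f\circ i=g$ (an equality) and $P$ is represented by $f$ compatibly with $\xi$, i.e. by some cartesian cell $\psi\colon P\Rightarrow U_d$ with frames $(f,1_d)$ whose composite with the canonical cell $c_M(1,i)\odot P\Rightarrow P$ (frames $(i,1_d)$) is $\xi$. Theorem. An equipment $\mathbb D$ is exact if and only if it satisfies Wood's axiom 5. -/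

import Mathlib

/-! ## Monads, modules and bimodules in a bicategory

Composition of 1-cells is written in diagrammatic order: `X ≫ Y : a ⟶ c` for `X : a ⟶ b`,
`Y : b ⟶ c`. -/

namespace CategoryTheory.Bicategory

universe w₁ v₁ u₁

section

variable {B : Type u₁} [Bicategory.{w₁, v₁} B]

/-- A monad on the object `a` of a bicategory. -/
structure Mnd (a : B) where
  /-- the underlying 1-cell -/
  t : a ⟶ a
  /-- the unit -/
  η : 𝟙 a ⟶ t
  /-- the multiplication -/
  μ : t ≫ t ⟶ t
  η_μ : η ▷ t ≫ μ = (λ_ t).hom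
  μ_η : t ◁ η ≫ μ = (ρ_ t).hom
  assoc : μ ▷ t ≫ μ = (α_ t t t).hom ≫ t ◁ μ ≫ μ

/-- A left `M`-module with target `b`: a 1-cell `X : a ⟶ b` with an action `M ≫ X ⟶ X`. -/
structure LMod {a : B} (M : Mnd a) (b : B) where
  X : a ⟶ b
  act : M.t ≫ X ⟶ X
  unit_act : M.η ▷ X ≫ act = (λ_ X).hom
  mul_act : M.μ ▷ X ≫ act = (α_ M.t M.t X).hom ≫ M.t ◁ act ≫ act

/-- A right `M`-module with source `b`: a 1-cell `X : b ⟶ a` with an action `X ≫ M ⟶ X`. -/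
structure RMod {a : B} (M : Mnd a) (b : B) where
  X : b ⟶ a
  act : X ≫ M.t ⟶ X
  act_unit : X ◁ M.η ≫ act = (ρ_ X).hom
  act_mul : X ◁ M.μ ≫ act = (α_ X M.t M.t).inv ≫ act ▷ M.t ≫ act

/-- An `(M, N)`-bimodule. -/
structure Bimodule {a b : B} (M : Mnd a) (N : Mnd b) where
  X : a ⟶ b
  l : M.t ≫ X ⟶ X
  r : X ≫ N.t ⟶ X
  unit_l : M.η ▷ X ≫ l = (λ_ X).hom
  mul_l : M.μ ▷ X ≫ l = (α_ M.t M.t X).hom ≫ M.t ◁ l ≫ l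
  r_unit : X ◁ N.η ≫ r = (ρ_ X).hom
  r_mul : X ◁ N.μ ≫ r = (α_ X N.t N.t).inv ≫ r ▷ N.t ≫ r
  l_r : l ▷ N.t ≫ r = (α_ M.t X N.t).hom ≫ M.t ◁ r ≫ l

/-- The unit bimodule of a monad: the monad acting on itself from both sides. -/
def Bimodule.unit {a : B} (M : Mnd a) : Bimodule M M where
  X := M.t
  l := M.μ
  r := M.μ
  unit_l := M.η_μ
  mul_l := M.assoc
  r_unit := M.μ_η
  r_mul := by rw [M.assoc]; simp
  l_r := M.assoc

variable {a b : B} {M : Mnd a}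

/-- Morphisms of left modules over a fixed target: 2-cells commuting with the actions. -/
@[ext]
structure LMod.Hom (X Y : LMod M b) where
  hom : X.X ⟶ Y.X
  comm : X.act ≫ hom = M.t ◁ hom ≫ Y.act

instance : Category (LMod M b) where
  Hom := LMod.Hom
  id X := { hom := 𝟙 X.X, comm := by simp }
  comp f g :=
    { hom := f.hom ≫ g.hom
      comm := by rw [← Category.assoc, f.comm, Category.assoc, g.comm]; simp }
  id_comp _ := by apply LMod.Hom.ext; simp
  comp_id _ := by apply LMod.Hom.ext; simp
  assoc _ _ _ := by apply LMod.Hom.ext; simp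

/-- Morphisms of right modules over a fixed source: 2-cells commuting with the actions. -/
@[ext]
structure RMod.Hom (X Y : RMod M b) where
  hom : X.X ⟶ Y.X
  comm : X.act ≫ hom = hom ▷ M.t ≫ Y.act

instance : Category (RMod M b) where
  Hom := RMod.Hom
  id X := { hom := 𝟙 X.X, comm := by simp }
  comp f g :=
    { hom := f.hom ≫ g.hom
      comm := by rw [← Category.assoc, f.comm, Category.assoc, g.comm]; simp }
  id_comp _ := by apply RMod.Hom.ext; simp
  comp_id _ := by apply RMod.Hom.ext; simp
  assoc _ _ _ := by apply RMod.Hom.ext; simp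

/-- Composing a left module `L` with target `q` with 1-cells out of `q`. -/
def LMod.extend {q : B} (L : LMod M q) (b : B) : (q ⟶ b) ⥤ LMod M b where
  obj Y :=
    { X := L.X ≫ Y
      act := (α_ M.t L.X Y).inv ≫ L.act ▷ Y
      unit_act := by
        have h := congrArg (fun t => t ▷ Y) L.unit_act
        simp only [comp_whiskerRight] at h
        simp [h]
      mul_act := by
        have h := congrArg (fun t => t ▷ Y) L.mul_act
        simp only [comp_whiskerRight] at h
        simp [h] }
  map ψ :=
    { hom := L.X ◁ ψ
      comm := by
        have h := whisker_exchange L.act ψ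
        simp [← h] }
  map_id _ := by apply LMod.Hom.ext; exact whiskerLeft_id _ _
  map_comp _ _ := by apply LMod.Hom.ext; exact whiskerLeft_comp _ _ _

/-- Composing 1-cells into `q` with a right module `R` with source `q`. -/
def RMod.extend {q : B} (R : RMod M q) (b : B) : (b ⟶ q) ⥤ RMod M b where
  obj Y :=
    { X := Y ≫ R.X
      act := (α_ Y R.X M.t).hom ≫ Y ◁ R.act
      act_unit := by
        have h := congrArg (fun t => Y ◁ t) R.act_unit
        simp only [whiskerLeft_comp] at h
        simp [h]
      act_mul := by
        have h := congrArg (fun t => Y ◁ t) R.act_mul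
        simp only [whiskerLeft_comp] at h
        simp [h] }
  map ψ :=
    { hom := ψ ▷ R.X
      comm := by simp [whisker_exchange] }
  map_id _ := by apply RMod.Hom.ext; exact id_whiskerRight _ _
  map_comp _ _ := by apply RMod.Hom.ext; exact comp_whiskerRight _ _ _

/-- `L : a ⟶ q` is a universal left `M`-module, i.e. it exhibits `q` as a Kleisli object of `M`:
composition with `L` is an equivalence from `B(q, b)` to left `M`-modules with target `b`,
for every `b`. -/
def LMod.IsUniversal {q : B} (L : LMod M q) : Prop :=
  ∀ b : B, (L.extend b).IsEquivalence

/-- `R : q ⟶ a` is a universal right `M`-module, i.e. it exhibits `q` as an Eilenberg–Moore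
object of `M`. -/
def RMod.IsUniversal {q : B} (R : RMod M q) : Prop :=
  ∀ b : B, (R.extend b).IsEquivalence

end

end CategoryTheory.Bicategory

/-! ## Pseudo double categories and equipments -/

open CategoryTheory

universe z w v u

/-- A (pseudo) double category. The category structure on `D` is the vertical category;
`Pro a b` are the proarrows `a ⇸ b`; `Cell f g A B` are the cells with source `A`, target `B`,
left frame `f` and right frame `g`. Vertical composition is strictly associative and unital,
horizontal composition `hcomp` (in diagrammatic order) only up to coherent invertible cells.

Vertical composition of cells takes as extra arguments names `h`, `k` for the composite frames,
with proofs that they are the composites, so that the strict laws can be stated as equations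
in one type of cells. -/
class DoubleCategory (D : Type u) extends Category.{v} D where
  Pro : D → D → Type w
  Cell : ∀ {a b a' b' : D}, (a ⟶ a') → (b ⟶ b') → Pro a b → Pro a' b' → Type z
  -- vertical structure
  idCell : ∀ {a b : D} (A : Pro a b), Cell (𝟙 a) (𝟙 b) A A
  vcomp : ∀ {a b a' b' a'' b'' : D} {f : a ⟶ a'} {g : b ⟶ b'} {f' : a' ⟶ a''} {g' : b' ⟶ b''}
    {A : Pro a b} {A' : Pro a' b'} {A'' : Pro a'' b''} {h : a ⟶ a''} {k : b ⟶ b''}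
    (_ : Cell f g A A') (_ : Cell f' g' A' A'') (_ : f ≫ f' = h) (_ : g ≫ g' = k),
    Cell h k A A''
  id_vcomp : ∀ {a b a' b' : D} {f : a ⟶ a'} {g : b ⟶ b'} {A : Pro a b} {A' : Pro a' b'}
    (φ : Cell f g A A'), vcomp (idCell A) φ (Category.id_comp f) (Category.id_comp g) = φ
  vcomp_id : ∀ {a b a' b' : D} {f : a ⟶ a'} {g : b ⟶ b'} {A : Pro a b} {A' : Pro a' b'}
    (φ : Cell f g A A'), vcomp φ (idCell A') (Category.comp_id f) (Category.comp_id g) = φ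
  vcomp_assoc : ∀ {a₀ b₀ a₁ b₁ a₂ b₂ a₃ b₃ : D}
    {f₁ : a₀ ⟶ a₁} {g₁ : b₀ ⟶ b₁} {f₂ : a₁ ⟶ a₂} {g₂ : b₁ ⟶ b₂} {f₃ : a₂ ⟶ a₃} {g₃ : b₂ ⟶ b₃}
    {A₀ : Pro a₀ b₀} {A₁ : Pro a₁ b₁} {A₂ : Pro a₂ b₂} {A₃ : Pro a₃ b₃}
    (φ₁ : Cell f₁ g₁ A₀ A₁) (φ₂ : Cell f₂ g₂ A₁ A₂) (φ₃ : Cell f₃ g₃ A₂ A₃)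
    {f₁₂ : a₀ ⟶ a₂} {g₁₂ : b₀ ⟶ b₂} {f₂₃ : a₁ ⟶ a₃} {g₂₃ : b₁ ⟶ b₃}
    {h : a₀ ⟶ a₃} {k : b₀ ⟶ b₃}
    (p₁₂ : f₁ ≫ f₂ = f₁₂) (q₁₂ : g₁ ≫ g₂ = g₁₂) (p₂₃ : f₂ ≫ f₃ = f₂₃) (q₂₃ : g₂ ≫ g₃ = g₂₃)
    (p : f₁₂ ≫ f₃ = h) (q : g₁₂ ≫ g₃ = k) (p' : f₁ ≫ f₂₃ = h) (q' : g₁ ≫ g₂₃ = k),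
    vcomp (vcomp φ₁ φ₂ p₁₂ q₁₂) φ₃ p q = vcomp φ₁ (vcomp φ₂ φ₃ p₂₃ q₂₃) p' q'
  -- horizontal units
  U : ∀ a : D, Pro a a
  unitCell : ∀ {a b : D} (f : a ⟶ b), Cell f f (U a) (U b)
  unitCell_id : ∀ a : D, unitCell (𝟙 a) = idCell (U a)
  unitCell_comp : ∀ {a b c : D} (f : a ⟶ b) (g : b ⟶ c),
    unitCell (f ≫ g) = vcomp (unitCell f) (unitCell g) rfl rfl
  -- horizontal composition
  pcomp : ∀ {a b c : D}, Pro a b → Pro b c → Pro a c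
  hcomp : ∀ {a b c a' b' c' : D} {f : a ⟶ a'} {g : b ⟶ b'} {h : c ⟶ c'}
    {A : Pro a b} {B : Pro b c} {A' : Pro a' b'} {B' : Pro b' c'}
    (_ : Cell f g A A') (_ : Cell g h B B'), Cell f h (pcomp A B) (pcomp A' B')
  hcomp_id : ∀ {a b c : D} (A : Pro a b) (B : Pro b c),
    hcomp (idCell A) (idCell B) = idCell (pcomp A B)
  interchange : ∀ {a b c a' b' c' a'' b'' c'' : D}
    {f : a ⟶ a'} {g : b ⟶ b'} {h : c ⟶ c'} {f' : a' ⟶ a''} {g' : b' ⟶ b''} {h' : c' ⟶ c''}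
    {A : Pro a b} {B : Pro b c} {A' : Pro a' b'} {B' : Pro b' c'}
    {A'' : Pro a'' b''} {B'' : Pro b'' c''}
    {ff : a ⟶ a''} {gg : b ⟶ b''} {hh : c ⟶ c''}
    (φ : Cell f g A A') (ψ : Cell g h B B') (φ' : Cell f' g' A' A'') (ψ' : Cell g' h' B' B'')
    (p : f ≫ f' = ff) (q : g ≫ g' = gg) (r : h ≫ h' = hh),
    hcomp (vcomp φ φ' p q) (vcomp ψ ψ' q r) = vcomp (hcomp φ ψ) (hcomp φ' ψ') p r
  -- associator
  assocHom : ∀ {a b c d : D} (A : Pro a b) (B : Pro b c) (C : Pro c d),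
    Cell (𝟙 a) (𝟙 d) (pcomp (pcomp A B) C) (pcomp A (pcomp B C))
  assocInv : ∀ {a b c d : D} (A : Pro a b) (B : Pro b c) (C : Pro c d),
    Cell (𝟙 a) (𝟙 d) (pcomp A (pcomp B C)) (pcomp (pcomp A B) C)
  assoc_hom_inv : ∀ {a b c d : D} (A : Pro a b) (B : Pro b c) (C : Pro c d),
    vcomp (assocHom A B C) (assocInv A B C) (Category.comp_id _) (Category.comp_id _) = idCell _
  assoc_inv_hom : ∀ {a b c d : D} (A : Pro a b) (B : Pro b c) (C : Pro c d),
    vcomp (assocInv A B C) (assocHom A B C) (Category.comp_id _) (Category.comp_id _) = idCell _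
  assoc_natural : ∀ {a b c d a' b' c' d' : D}
    {f : a ⟶ a'} {g : b ⟶ b'} {h : c ⟶ c'} {k : d ⟶ d'}
    {A : Pro a b} {B : Pro b c} {C : Pro c d} {A' : Pro a' b'} {B' : Pro b' c'} {C' : Pro c' d'}
    (φ : Cell f g A A') (ψ : Cell g h B B') (χ : Cell h k C C'),
    vcomp (hcomp (hcomp φ ψ) χ) (assocHom A' B' C') (Category.comp_id f) (Category.comp_id k) =
      vcomp (assocHom A B C) (hcomp φ (hcomp ψ χ)) (Category.id_comp f) (Category.id_comp k)
  -- unitors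
  lunitHom : ∀ {a b : D} (A : Pro a b), Cell (𝟙 a) (𝟙 b) (pcomp (U a) A) A
  lunitInv : ∀ {a b : D} (A : Pro a b), Cell (𝟙 a) (𝟙 b) A (pcomp (U a) A)
  lunit_hom_inv : ∀ {a b : D} (A : Pro a b),
    vcomp (lunitHom A) (lunitInv A) (Category.comp_id _) (Category.comp_id _) = idCell _
  lunit_inv_hom : ∀ {a b : D} (A : Pro a b),
    vcomp (lunitInv A) (lunitHom A) (Category.comp_id _) (Category.comp_id _) = idCell _
  lunit_natural : ∀ {a b a' b' : D} {f : a ⟶ a'} {g : b ⟶ b'} {A : Pro a b} {A' : Pro a' b'}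
    (φ : Cell f g A A'),
    vcomp (hcomp (unitCell f) φ) (lunitHom A') (Category.comp_id f) (Category.comp_id g) =
      vcomp (lunitHom A) φ (Category.id_comp f) (Category.id_comp g)
  runitHom : ∀ {a b : D} (A : Pro a b), Cell (𝟙 a) (𝟙 b) (pcomp A (U b)) A
  runitInv : ∀ {a b : D} (A : Pro a b), Cell (𝟙 a) (𝟙 b) A (pcomp A (U b))
  runit_hom_inv : ∀ {a b : D} (A : Pro a b),
    vcomp (runitHom A) (runitInv A) (Category.comp_id _) (Category.comp_id _) = idCell _
  runit_inv_hom : ∀ {a b : D} (A : Pro a b),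
    vcomp (runitInv A) (runitHom A) (Category.comp_id _) (Category.comp_id _) = idCell _
  runit_natural : ∀ {a b a' b' : D} {f : a ⟶ a'} {g : b ⟶ b'} {A : Pro a b} {A' : Pro a' b'}
    (φ : Cell f g A A'),
    vcomp (hcomp φ (unitCell g)) (runitHom A') (Category.comp_id f) (Category.comp_id g) =
      vcomp (runitHom A) φ (Category.id_comp f) (Category.id_comp g)
  -- coherence
  pentagon : ∀ {a b c d e : D} (A : Pro a b) (B : Pro b c) (C : Pro c d) (E : Pro d e),
    vcomp (hcomp (assocHom A B C) (idCell E))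
        (vcomp (assocHom A (pcomp B C) E) (hcomp (idCell A) (assocHom B C E))
          (Category.comp_id _) (Category.comp_id _))
        (Category.comp_id _) (Category.comp_id _) =
      vcomp (assocHom (pcomp A B) C E) (assocHom A B (pcomp C E))
        (Category.comp_id _) (Category.comp_id _)
  triangle : ∀ {a b c : D} (A : Pro a b) (B : Pro b c),
    vcomp (assocHom A (U b) B) (hcomp (idCell A) (lunitHom B))
        (Category.comp_id _) (Category.comp_id _) =
      hcomp (runitHom A) (idCell B)

namespace DoubleCategory

section

variable (D : Type u) [DoubleCategory.{z, w, v} D]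

/-- The category of proarrows `a ⇸ b`, whose morphisms are the cells with identity frames. -/
instance proCategory (a b : D) : Category.{z} (Pro a b) where
  Hom A B := Cell (𝟙 a) (𝟙 b) A B
  id A := idCell A
  comp φ ψ := vcomp φ ψ (Category.comp_id _) (Category.comp_id _)
  id_comp φ := id_vcomp φ
  comp_id φ := vcomp_id φ
  assoc φ ψ χ := vcomp_assoc φ ψ χ _ _ _ _ _ _ _ _

variable {D}

/-- The associator as an isomorphism of proarrows. -/
def assocIso {a b c d : D} (A : Pro a b) (B : Pro b c) (C : Pro c d) :
    pcomp (pcomp A B) C ≅ pcomp A (pcomp B C) :=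
  ⟨assocHom A B C, assocInv A B C, assoc_hom_inv A B C, assoc_inv_hom A B C⟩

/-- The left unitor as an isomorphism of proarrows. -/
def lunitIso {a b : D} (A : Pro a b) : pcomp (U a) A ≅ A :=
  ⟨lunitHom A, lunitInv A, lunit_hom_inv A, lunit_inv_hom A⟩

/-- The right unitor as an isomorphism of proarrows. -/
def runitIso {a b : D} (A : Pro a b) : pcomp A (U b) ≅ A :=
  ⟨runitHom A, runitInv A, runit_hom_inv A, runit_inv_hom A⟩

/-- Horizontal composite of morphisms of proarrows. -/
def hmap {a b c : D} {A A' : Pro a b} {B B' : Pro b c} (φ : A ⟶ A') (ψ : B ⟶ B') :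
    pcomp A B ⟶ pcomp A' B' :=
  hcomp φ ψ

theorem hmap_id {a b c : D} (A : Pro a b) (B : Pro b c) :
    hmap (𝟙 A) (𝟙 B) = 𝟙 (pcomp A B) :=
  hcomp_id A B

theorem hmap_comp {a b c : D} {A A' A'' : Pro a b} {B B' B'' : Pro b c}
    (φ : A ⟶ A') (ψ : B ⟶ B') (φ' : A' ⟶ A'') (ψ' : B' ⟶ B'') :
    hmap (φ ≫ φ') (ψ ≫ ψ') = hmap φ ψ ≫ hmap φ' ψ' :=
  interchange φ ψ φ' ψ' _ _ _

theorem hmap_assoc {a b c d : D} {A A' : Pro a b} {B B' : Pro b c} {C C' : Pro c d}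
    (φ : A ⟶ A') (ψ : B ⟶ B') (χ : C ⟶ C') :
    hmap (hmap φ ψ) χ ≫ (assocIso A' B' C').hom =
      (assocIso A B C).hom ≫ hmap φ (hmap ψ χ) :=
  assoc_natural φ ψ χ

theorem hmap_lunit {a b : D} {A A' : Pro a b} (φ : A ⟶ A') :
    hmap (𝟙 (U a)) φ ≫ (lunitIso A').hom = (lunitIso A).hom ≫ φ := by
  have h := lunit_natural φ
  rw [unitCell_id] at h
  exact h

theorem hmap_runit {a b : D} {A A' : Pro a b} (φ : A ⟶ A') :
    hmap φ (𝟙 (U b)) ≫ (runitIso A').hom = (runitIso A).hom ≫ φ := by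
  have h := runit_natural φ
  rw [unitCell_id] at h
  exact h

variable (D)

/-- The objects of the horizontal bicategory of `D`: the objects of `D`. -/
structure Hor : Type u where
  /-- the underlying object of `D` -/
  obj : D

/-- The horizontal bicategory: its 1-cells are the proarrows, and its 2-cells are the cells
whose left and right frames are identities. -/
instance Hor.bicategory : Bicategory.{z, w} (Hor D) where
  Hom a b := Pro a.obj b.obj
  id a := U a.obj
  comp A B := pcomp A B
  homCategory a b := proCategory D a.obj b.obj
  whiskerLeft A _ _ φ := hmap (𝟙 A) φ
  whiskerRight φ B := hmap φ (𝟙 B)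
  associator A B C := assocIso A B C
  leftUnitor A := lunitIso A
  rightUnitor A := runitIso A
  whiskerLeft_id A B := hmap_id A B
  whiskerLeft_comp A _ _ _ φ ψ := by
    rw [← hmap_comp, Category.id_comp]
  id_whiskerLeft φ := by
    rw [← Category.assoc, Iso.eq_comp_inv]
    exact hmap_lunit φ
  comp_whiskerLeft A B _ _ φ := by
    rw [← Category.assoc, Iso.eq_comp_inv, ← hmap_id]
    exact hmap_assoc _ _ _
  id_whiskerRight A B := hmap_id A B
  comp_whiskerRight φ ψ B := by
    rw [← hmap_comp, Category.id_comp]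
  whiskerRight_id φ := by
    rw [← Category.assoc, Iso.eq_comp_inv]
    exact hmap_runit φ
  whiskerRight_comp φ B C := by
    rw [Iso.eq_inv_comp, ← hmap_id]
    exact (hmap_assoc _ _ _).symm
  whisker_assoc A _ _ φ C := by
    rw [← Category.assoc, Iso.eq_comp_inv]
    exact hmap_assoc _ _ _
  whisker_exchange φ ψ := by
    rw [← hmap_comp, ← hmap_comp, Category.id_comp, Category.comp_id, Category.id_comp,
      Category.comp_id]
  pentagon A B C E := pentagon A B C E
  triangle A B := triangle A B

variable {D}

/-- A cell `φ : P ⟶ Q` with frames `f`, `g` is cartesian if every cell into `Q` whose frames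
factor through `f` and `g` factors uniquely through `φ`. It exhibits `P` as the restriction
`Q(g, f)`. -/
def IsCartesian {a b a' b' : D} {f : a ⟶ a'} {g : b ⟶ b'} {P : Pro a b} {Q : Pro a' b'}
    (φ : Cell f g P Q) : Prop :=
  ∀ {x y : D} (h : x ⟶ a) (k : y ⟶ b) (R : Pro x y) (χ : Cell (h ≫ f) (k ≫ g) R Q),
    ∃! ψ : Cell h k R P, vcomp ψ φ rfl rfl = χ

variable (D) in
/-- An equipment (framed bicategory) is a double category with all restrictions. -/
def IsEquipment : Prop :=
  ∀ {a b a' b' : D} (f : a ⟶ a') (g : b ⟶ b') (Q : Pro a' b'),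
    ∃ (P : Pro a b) (φ : Cell f g P Q), IsCartesian φ

/-- Precomposition of a cell with a cell with identity frames. -/
abbrev pre {a b a' b' : D} {f : a ⟶ a'} {g : b ⟶ b'} {A A' : Pro a b} {B : Pro a' b'}
    (θ : A ⟶ A') (φ : Cell f g A' B) : Cell f g A B :=
  vcomp θ φ (Category.id_comp f) (Category.id_comp g)

/-- Postcomposition of a cell with a cell with identity frames. -/
abbrev post {a b a' b' : D} {f : a ⟶ a'} {g : b ⟶ b'} {A : Pro a b} {B B' : Pro a' b'}
    (φ : Cell f g A B) (θ : B ⟶ B') : Cell f g A B' :=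
  vcomp φ θ (Category.comp_id f) (Category.comp_id g)

/-! ## Monoids, bimodules, embeddings -/

/-- A monoid in `D` on the object `c`, i.e. a monad in the horizontal bicategory. -/
abbrev Mon (c : D) := Bicategory.Mnd (B := Hor D) ⟨c⟩

/-- The underlying proarrow of a monoid. -/
abbrev Mon.pro {c : D} (M : Mon c) : Pro c c := M.t

/-- A bimodule from the monoid `M` on `c` to the monoid `N` on `d`. -/
abbrev Bimod {c d : D} (M : Mon c) (N : Mon d) := Bicategory.Bimodule (B := Hor D) M N

/-- The underlying proarrow of a bimodule. -/
abbrev Bimod.pro {c d : D} {M : Mon c} {N : Mon d} (B : Bimod M N) : Pro c d := B.X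

/-- An embedding of the monoid `M` into the object `x` with underlying vertical arrow `f`: a cell
`M ⟶ U x` with both frames `f` which respects the units and multiplications of `M` and of the
trivial monoid `U x`. -/
structure Embedding {c x : D} (M : Mon c) (f : c ⟶ x) where
  cell : Cell f f (Mon.pro M) (U x)
  unit : pre M.η cell = unitCell f
  mul : pre M.μ cell = post (hcomp cell cell) (lunitHom (U x))

/-- The cell `φ : B ⟶ P` is an embedding of the bimodule `B` into the proarrow `P`, along the
monoid embeddings `F` and `G`: it respects the left and right actions, where the trivial monoids
on `x` and `y` act on `P` through the unitors. -/
structure IsBimodEmbedding {c d x y : D} {M : Mon c} {N : Mon d} {f : c ⟶ x} {g : d ⟶ y}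
    (F : Embedding M f) (G : Embedding N g) (B : Bimod M N) {P : Pro x y}
    (φ : Cell f g (Bimod.pro B) P) : Prop where
  left : pre B.l φ = post (hcomp F.cell φ) (lunitHom P)
  right : pre B.r φ = post (hcomp φ G.cell) (runitHom P)

/-! ## Collapse -/

/-- The embedding `F` factors through the embedding `I` via the vertical arrow `h`. -/
def Embedding.Factors {c q x : D} {M : Mon c} {i : c ⟶ q} {f : c ⟶ x}
    (I : Embedding M i) (F : Embedding M f) (h : q ⟶ x) : Prop :=
  ∃ e : i ≫ h = f, vcomp I.cell (unitCell h) e e = F.cell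

/-- A collapse of `M`: an embedding through which every embedding factors uniquely. -/
def Embedding.IsCollapse {c q : D} {M : Mon c} {i : c ⟶ q} (I : Embedding M i) : Prop :=
  ∀ {x : D} {f : c ⟶ x} (F : Embedding M f), ∃! h : q ⟶ x, I.Factors F h

/-- A collapse of the bimodule `B`: an embedding `φ` of `B` along collapses `I` of `M` and `J` of
`N`, such that every embedding `χ` of `B` into some `Q`, along embeddings `F = h ∘ I` and
`G = k ∘ J`, factors through `φ` via a unique cell with frames `h` and `k`. -/
structure IsBimodCollapse {c d q r : D} {M : Mon c} {N : Mon d} {i : c ⟶ q} {j : d ⟶ r}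
    (I : Embedding M i) (J : Embedding N j) (B : Bimod M N) {P : Pro q r}
    (φ : Cell i j (Bimod.pro B) P) : Prop where
  collapse_left : I.IsCollapse
  collapse_right : J.IsCollapse
  embedding : IsBimodEmbedding I J B φ
  universal : ∀ {x y : D} {f : c ⟶ x} {g : d ⟶ y} (F : Embedding M f) (G : Embedding N g)
    {Q : Pro x y} (χ : Cell f g (Bimod.pro B) Q), IsBimodEmbedding F G B χ →
    ∀ (h : q ⟶ x) (k : r ⟶ y) (hF : I.Factors F h) (hG : J.Factors G k),
      ∃! ψ : Cell h k P Q, vcomp φ ψ hF.1 hG.1 = χ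

/-- A normal collapse: a collapse of `M` whose cell is also a bimodule collapse of the unit
bimodule of `M`. -/
def Embedding.IsNormalCollapse {c q : D} {M : Mon c} {i : c ⟶ q} (I : Embedding M i) : Prop :=
  I.IsCollapse ∧ IsBimodCollapse I I (Bicategory.Bimodule.unit M) (P := U q) I.cell

/-! ## Regular and exact equipments -/

/-- The embedding `F` exhibits `M` as the kernel of `f`, i.e. as the restriction along `f` of the
trivial monoid on `x`. -/
def Embedding.IsKernel {c x : D} {M : Mon c} {f : c ⟶ x} (F : Embedding M f) : Prop :=
  IsCartesian F.cell

/-- `M` is effective if it is the kernel of some vertical arrow. -/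
def MonEffective {c : D} (M : Mon c) : Prop :=
  ∃ (x : D) (f : c ⟶ x) (F : Embedding M f), F.IsKernel

/-- `B` is effective if its monoids are kernels of vertical arrows `f` and `g`, and `B` is the
restriction along `f` and `g` of some proarrow; i.e. if it has a cartesian embedding. -/
def BimodEffective {c d : D} {M : Mon c} {N : Mon d} (B : Bimod M N) : Prop :=
  ∃ (x y : D) (f : c ⟶ x) (g : d ⟶ y) (F : Embedding M f) (G : Embedding N g)
    (P : Pro x y) (φ : Cell f g (Bimod.pro B) P),
    F.IsKernel ∧ G.IsKernel ∧ IsBimodEmbedding F G B φ ∧ IsCartesian φ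

/-- `f` is a regular cover if the cartesian cell from its kernel is a normal collapse. -/
def IsRegularCover {c d : D} (f : c ⟶ d) : Prop :=
  ∃ (K : Mon c) (F : Embedding K f), F.IsKernel ∧ F.IsNormalCollapse

variable (D) in
/-- Regular equipments. -/
structure IsRegular : Prop where
  /-- every effective monoid has a normal collapse -/
  collapse : ∀ {c : D} (M : Mon c), MonEffective M →
    ∃ (q : D) (i : c ⟶ q) (I : Embedding M i), I.IsNormalCollapse
  /-- for regular covers `f`, `g` and a proarrow `B`, the cartesian embedding of the
  `(ker f, ker g)`-bimodule `B(g, f)` into `B` is a bimodule collapse -/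
  bimodCollapse : ∀ {c d c' d' : D} (f : c ⟶ d) (g : c' ⟶ d'),
    IsRegularCover f → IsRegularCover g → ∀ (B : Pro d d')
    {K : Mon c} {L : Mon c'} (F : Embedding K f) (G : Embedding L g),
    F.IsKernel → G.IsKernel → ∀ (R : Bimod K L) (φ : Cell f g (Bimod.pro R) B),
    IsBimodEmbedding F G R φ → IsCartesian φ → IsBimodCollapse F G R φ

variable (D) in
/-- Exact equipments: regular, and every monoid and every bimodule is effective. -/
structure IsExact : Prop where
  regular : IsRegular D
  monEffective : ∀ {c : D} (M : Mon c), MonEffective M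
  bimodEffective : ∀ {c d : D} {M : Mon c} {N : Mon d} (B : Bimod M N), BimodEffective B

/-! ## Wood's axiom 5 -/

/-- The cell `ξ : P ⟶ U d` with frames `f` and the identity represents `P` by `f`, i.e. exhibits
`P` as `d(1, f)`. -/
def Represents {c d : D} {P : Pro c d} {f : c ⟶ d} (ξ : Cell f (𝟙 d) P (U d)) : Prop :=
  IsCartesian ξ

/-- The proarrow `P : c ⇸ d` is representable. -/
def IsRepresentable {c d : D} (P : Pro c d) : Prop :=
  ∃ (f : c ⟶ d) (ξ : Cell f (𝟙 d) P (U d)), Represents ξ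

/-- For a cell `ι : I ⟶ U q` with frames `i` and the identity, the induced cell `I ⊙ P ⟶ P` with
the same frames. -/
def restrictCell {c q d : D} {i : c ⟶ q} {I : Pro c q} (ι : Cell i (𝟙 q) I (U q)) (P : Pro q d) :
    Cell i (𝟙 d) (pcomp I P) P :=
  post (hcomp ι (idCell P)) (lunitHom P)

variable (D) in
/-- Wood's axiom 5 (strict form). For every monoid `M` on `c` there are an object `q`, a vertical
arrow `i : c ⟶ q` and a cell `ι : M ⟶ U q` with frames `i`, together with representing cells
`α : I ⟶ U q` of `I = q(1, i)` and `β : J ⟶ U q` of `J = q(i, 1)`, where `I = L.X` and `J = R.X`,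
such that
* the cell `M ⊙ I ⟶ I` corresponding to `ι` makes `I` a universal left `M`-module,
* the cell `J ⊙ M ⟶ J` corresponding to `ι` makes `J` a universal right `M`-module,
* a proarrow `P : q ⇸ d` is representable iff `I ⊙ P` is; and if `ξ` represents `I ⊙ P` by
  `g : c ⟶ d`, there is a unique `f : q ⟶ d` with `f ∘ i = g` such that `P` is represented by `f`
  compatibly with `ξ`. -/
def WoodAxiom5 : Prop :=
  ∀ {c : D} (M : Mon c), ∃ (q : D) (i : c ⟶ q) (ι : Cell i i (Mon.pro M) (U q))
    (L : Bicategory.LMod (B := Hor D) M ⟨q⟩) (α : Cell i (𝟙 q) L.X (U q))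
    (R : Bicategory.RMod (B := Hor D) M ⟨q⟩) (β : Cell (𝟙 q) i R.X (U q)),
    IsCartesian α ∧ IsCartesian β ∧
    pre L.act α = post (hcomp ι α) (lunitHom (U q)) ∧
    pre R.act β = post (hcomp β ι) (lunitHom (U q)) ∧
    L.IsUniversal ∧
    R.IsUniversal ∧
    (∀ {d : D} (P : Pro q d), IsRepresentable P ↔ IsRepresentable (pcomp (D := D) L.X P)) ∧
    (∀ {d : D} (P : Pro q d) (g : c ⟶ d) (ξ : Cell g (𝟙 d) (pcomp (D := D) L.X P) (U d)),
      Represents ξ →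
      ∃! f : q ⟶ d, ∃ (e : i ≫ f = g) (ψ : Cell f (𝟙 d) P (U d)),
        Represents ψ ∧ vcomp (restrictCell α P) ψ e (Category.comp_id (𝟙 d)) = ξ)

end

end DoubleCategory

/-!
Both conditions say that the collapse `i : c ⟶ q` of a monoid `M` is universal for modules: every
left `M`-module is the restriction along `i` of a proarrow out of `q`, by a cartesian cell that is
initial among the left embeddings along `i`, and dually for right modules.

In an exact equipment this is the case of bimodules with a trivial monoid on the other side. A
representation of `q(1, i) ⊙ P` by `g` yields an embedding of `M` along `g`, and the factorization
of the latter through the collapse is the arrow representing `P`.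

Conversely, a universal module cell whose representations descend is a collapse. A bimodule is
collapsed one side at a time, the second side by the dual property. Applied to `M` as a module over
itself, universality produces the conjoint of `i` and shows that `M` is the kernel of `i`.
-/

namespace DoubleCategory

open Category
open scoped Bicategory

/- These unfold to `vcomp` rather than to `pre` and `post`, so that the associativity lemmas apply
uniformly. -/

local notation:80 θ:81 " ≫ˡ " φ:80 => vcomp θ φ (Category.id_comp _) (Category.id_comp _)

local notation:80 φ:81 " ≫ʳ " θ:80 => vcomp φ θ (Category.comp_id _) (Category.comp_id _)

variable {D : Type u} [DoubleCategory.{z, w, v} D]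

section Vertical

variable {a b a₁ b₁ a₂ b₂ a₃ b₃ : D} {f₁ : a ⟶ a₁} {g₁ : b ⟶ b₁} {f₂ : a₁ ⟶ a₂} {g₂ : b₁ ⟶ b₂}
  {f₃ : a₂ ⟶ a₃} {g₃ : b₂ ⟶ b₃} {f₁₂ : a ⟶ a₂} {g₁₂ : b ⟶ b₂} {f₂₃ : a₁ ⟶ a₃} {g₂₃ : b₁ ⟶ b₃}
  {f : a ⟶ a₃} {g : b ⟶ b₃} {A : Pro a b} {A₁ : Pro a₁ b₁} {A₂ : Pro a₂ b₂} {A₃ : Pro a₃ b₃}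

theorem vcomp_assoc_eq_right {φ₁ : Cell f₁ g₁ A A₁} {φ₂ : Cell f₂ g₂ A₁ A₂} {φ₃ : Cell f₃ g₃ A₂ A₃}
    {χ : Cell f₂₃ g₂₃ A₁ A₃} {p₁₂ : f₁ ≫ f₂ = f₁₂} {q₁₂ : g₁ ≫ g₂ = g₁₂} {p : f₁₂ ≫ f₃ = f}
    {q : g₁₂ ≫ g₃ = g} {p₂₃ : f₂ ≫ f₃ = f₂₃} {q₂₃ : g₂ ≫ g₃ = g₂₃}
    (e : vcomp φ₂ φ₃ p₂₃ q₂₃ = χ) :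
    vcomp (vcomp φ₁ φ₂ p₁₂ q₁₂) φ₃ p q =
      vcomp φ₁ χ (by rw [← p₂₃, ← p, ← p₁₂, assoc]) (by rw [← q₂₃, ← q, ← q₁₂, assoc]) := by
  subst e
  exact vcomp_assoc ..

theorem vcomp_assoc_eq_left {φ₁ : Cell f₁ g₁ A A₁} {φ₂ : Cell f₂ g₂ A₁ A₂} {φ₃ : Cell f₃ g₃ A₂ A₃}
    {χ : Cell f₁₂ g₁₂ A A₂} {p₂₃ : f₂ ≫ f₃ = f₂₃} {q₂₃ : g₂ ≫ g₃ = g₂₃} {p : f₁ ≫ f₂₃ = f}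
    {q : g₁ ≫ g₂₃ = g} {p₁₂ : f₁ ≫ f₂ = f₁₂} {q₁₂ : g₁ ≫ g₂ = g₁₂}
    (e : vcomp φ₁ φ₂ p₁₂ q₁₂ = χ) :
    vcomp φ₁ (vcomp φ₂ φ₃ p₂₃ q₂₃) p q =
      vcomp χ φ₃ (by rw [← p₁₂, ← p, ← p₂₃, assoc]) (by rw [← q₁₂, ← q, ← q₂₃, assoc]) := by
  subst e
  exact (vcomp_assoc ..).symm

theorem vcomp_left_cancel {A B : Pro a b} {θ' : Cell (𝟙 a) (𝟙 b) B A} {θ : Cell (𝟙 a) (𝟙 b) A B}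
    (e : θ' ≫ˡ θ = idCell B) {R : Pro a₁ b₁} {φ ψ : Cell f₁ g₁ B R} (h : θ ≫ˡ φ = θ ≫ˡ ψ) :
    φ = ψ := by
  rw [← id_vcomp φ, ← id_vcomp ψ, ← e, vcomp_assoc_eq_right h, vcomp_assoc_eq_right rfl]

theorem vcomp_unitCell_id {x : D} {f : a ⟶ x} {g : b ⟶ x} (φ : Cell f g A (U x)) :
    φ ≫ʳ unitCell (𝟙 x) = φ := by
  rw [unitCell_id, vcomp_id]

theorem unitCell_vcomp_unitCell {x y t : D} (f : x ⟶ y) (g : y ⟶ t) {h : x ⟶ t} (p : f ≫ g = h) :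
    vcomp (unitCell f) (unitCell g) p p = unitCell h := by
  subst p
  exact (unitCell_comp f g).symm

end Vertical

section HorizontalVertical

variable {a b c a' b' c' : D} {f : a ⟶ a'} {g : b ⟶ b'} {h : c ⟶ c'}
  {A : Pro a b} {B : Pro b c} {A' : Pro a' b'} {B' : Pro b' c'}

theorem hcomp_post_left {A'' : Pro a' b'} (φ : Cell f g A A') (θ : Cell (𝟙 a') (𝟙 b') A' A'')
    (ψ : Cell g h B B') : hcomp (φ ≫ʳ θ) ψ = hcomp φ ψ ≫ʳ hcomp θ (idCell B') := by
  rw [← interchange (q := comp_id g), vcomp_id]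

theorem hcomp_post_right {B'' : Pro b' c'} (φ : Cell f g A A') (ψ : Cell g h B B')
    (θ : Cell (𝟙 b') (𝟙 c') B' B'') : hcomp φ (ψ ≫ʳ θ) = hcomp φ ψ ≫ʳ hcomp (idCell A') θ := by
  rw [← interchange (q := comp_id g), vcomp_id]

theorem hcomp_idCell_vcomp_hcomp_idCell {A' : Pro a' b} {B'' : Pro b c} (φ : Cell f (𝟙 b) A A')
    (θ : Cell (𝟙 b) (𝟙 c) B B'') :
    hcomp φ (idCell B) ≫ʳ hcomp (idCell A') θ = hcomp (idCell A) θ ≫ˡ hcomp φ (idCell B'') := by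
  rw [← interchange (q := comp_id _), ← interchange (q := comp_id _), vcomp_id, id_vcomp, id_vcomp,
    vcomp_id]

theorem assoc_inv_natural {d d' : D} {k : d ⟶ d'} {C : Pro c d} {C' : Pro c' d'}
    (φ : Cell f g A A') (ψ : Cell g h B B') (χ : Cell h k C C') :
    hcomp φ (hcomp ψ χ) ≫ʳ assocInv A' B' C' = assocInv A B C ≫ˡ hcomp (hcomp φ ψ) χ := by
  refine vcomp_left_cancel (assoc_inv_hom A B C) ?_
  rw [vcomp_assoc_eq_left (assoc_hom_inv A B C), id_vcomp,
    vcomp_assoc_eq_left (assoc_natural φ ψ χ).symm, vcomp_assoc_eq_right (assoc_hom_inv A' B' C'),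
    vcomp_id]

theorem pentagon_inv {d e : D} (A : Pro a b) (B : Pro b c) (C : Pro c d) (E : Pro d e) :
    hcomp (idCell A) (assocInv B C E) ≫ˡ
        (assocInv A (pcomp B C) E ≫ˡ hcomp (assocInv A B C) (idCell E)) =
      assocInv A B (pcomp C E) ≫ˡ assocInv (pcomp A B) C E :=
  Bicategory.pentagon_inv (B := Hor D) (a := ⟨a⟩) (b := ⟨b⟩) (c := ⟨c⟩) (d := ⟨d⟩) (e := ⟨e⟩)
    A B C E

theorem triangle_inv (A : Pro a b) (B : Pro b c) :
    assocInv A (U b) B ≫ˡ hcomp (runitHom A) (idCell B) = hcomp (idCell A) (lunitHom B) :=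
  Bicategory.triangle_assoc_comp_right (B := Hor D) (a := ⟨a⟩) (b := ⟨b⟩) (c := ⟨c⟩) A B

end HorizontalVertical

/-- The horizontal opposite of a double category: proarrows and horizontal composition are
reversed, while vertical arrows keep their direction. It turns statements on left modules and
companions into statements on right modules and conjoints. -/
def HOp (D : Type u) : Type u := D

instance : DoubleCategory.{z, w, v} (HOp D) where
  toCategory := inferInstanceAs (Category D)
  Pro a b := Pro (D := D) b a
  Cell f g A B := Cell (D := D) g f A B
  idCell A := idCell (D := D) A
  vcomp φ ψ p q := vcomp (D := D) φ ψ q p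
  id_vcomp φ := id_vcomp (D := D) φ
  vcomp_id φ := vcomp_id (D := D) φ
  vcomp_assoc φ₁ φ₂ φ₃ _ _ _ _ _ _ p₁₂ q₁₂ p₂₃ q₂₃ p q p' q' :=
    vcomp_assoc (D := D) φ₁ φ₂ φ₃ q₁₂ p₁₂ q₂₃ p₂₃ q p q' p'
  U a := U (D := D) a
  unitCell f := unitCell (D := D) f
  unitCell_id a := unitCell_id (D := D) a
  unitCell_comp f g := unitCell_comp (D := D) f g
  pcomp A B := pcomp (D := D) B A
  hcomp φ ψ := hcomp (D := D) ψ φ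
  hcomp_id A B := hcomp_id (D := D) B A
  interchange φ ψ φ' ψ' p q r := interchange (D := D) ψ φ ψ' φ' r q p
  assocHom A B C := assocInv (D := D) C B A
  assocInv A B C := assocHom (D := D) C B A
  assoc_hom_inv A B C := assoc_inv_hom (D := D) C B A
  assoc_inv_hom A B C := assoc_hom_inv (D := D) C B A
  assoc_natural φ ψ χ := assoc_inv_natural (D := D) χ ψ φ
  lunitHom A := runitHom (D := D) A
  lunitInv A := runitInv (D := D) A
  lunit_hom_inv A := runit_hom_inv (D := D) A
  lunit_inv_hom A := runit_inv_hom (D := D) A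
  lunit_natural φ := runit_natural (D := D) φ
  runitHom A := lunitHom (D := D) A
  runitInv A := lunitInv (D := D) A
  runit_hom_inv A := lunit_hom_inv (D := D) A
  runit_inv_hom A := lunit_inv_hom (D := D) A
  runit_natural φ := lunit_natural (D := D) φ
  pentagon A B C E := pentagon_inv (D := D) E C B A
  triangle A B := triangle_inv (D := D) B A

/-- A cell, regarded as a cell of the horizontal opposite. -/
abbrev Cell.op {a b a' b' : D} {f : a ⟶ a'} {g : b ⟶ b'} {A : Pro a b} {B : Pro a' b'}
    (φ : Cell f g A B) : Cell (D := HOp D) g f A B := φ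

section UnitAction

variable {a b c d a' b' c' x y : D}

theorem lunitHom_U (x : D) : lunitHom (U x) = runitHom (U x) := by
  have h : ∀ a : Hor D, (λ_ (𝟙 a)).hom = (ρ_ (𝟙 a)).hom := fun a => by
    rw [Bicategory.unitors_equal]
  exact h ⟨x⟩

theorem assocHom_vcomp_lunitHom (A : Pro a b) (B : Pro b c) :
    assocHom (U a) A B ≫ˡ lunitHom (pcomp A B) = hcomp (lunitHom A) (idCell B) :=
  (Bicategory.leftUnitor_whiskerRight (B := Hor D) (a := ⟨a⟩) (b := ⟨b⟩) (c := ⟨c⟩) A B).symm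

/-- The horizontal composite of a cell into a unit with a cell into `P`, followed by the left
unitor of `P`. The compatibility of a cell with left actions is expressed through it. -/
def lact {f : a ⟶ x} {g : b ⟶ x} {h : c ⟶ y} {A : Pro a b} {B : Pro b c} {P : Pro x y}
    (φ : Cell f g A (U x)) (ψ : Cell g h B P) : Cell f h (pcomp A B) P :=
  post (hcomp φ ψ) (lunitHom P)

/-- The horizontal composite of a cell into `P` with a cell into a unit, followed by the right
unitor of `P`; this is `lact` in the horizontal opposite. -/
def ract {f : a ⟶ x} {g : b ⟶ y} {h : c ⟶ y} {A : Pro a b} {B : Pro b c} {P : Pro x y}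
    (ψ : Cell f g A P) (φ : Cell g h B (U y)) : Cell f h (pcomp A B) P :=
  post (hcomp ψ φ) (runitHom P)

section

variable {f : a ⟶ x} {g : b ⟶ x} {h : c ⟶ y} {A : Pro a b} {B : Pro b c} {P : Pro x y}

theorem lact_eq_ract {h : c ⟶ x} (φ : Cell f g A (U x)) (ψ : Cell g h B (U x)) :
    lact φ ψ = ract φ ψ := by
  rw [lact, ract, post, post, lunitHom_U]

theorem restrictCell_eq_lact {A : Pro a x} (α : Cell f (𝟙 x) A (U x)) (P : Pro x y) :
    restrictCell α P = lact α (idCell P) := rfl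

theorem hcomp_vcomp_lact {f' : a' ⟶ a} {g' : b' ⟶ b} {h' : c' ⟶ c} {A' : Pro a' b'}
    {B' : Pro b' c'} {s : a' ⟶ x} {m : b' ⟶ x} {t : c' ⟶ y} {θ : Cell f' g' A' A}
    {θ' : Cell g' h' B' B} {φ : Cell f g A (U x)} {ψ : Cell g h B P} {χ : Cell s m A' (U x)}
    {χ' : Cell m t B' P} {p : f' ≫ f = s} {q : g' ≫ g = m} {r : h' ≫ h = t}
    (e : vcomp θ φ p q = χ) (e' : vcomp θ' ψ q r = χ') :
    vcomp (hcomp θ θ') (lact φ ψ) p r = lact χ χ' := by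
  subst e e'
  rw [lact, lact, post, post, interchange, vcomp_assoc_eq_left rfl]

theorem lact_vcomp {x' y' : D} {s : x ⟶ x'} {t : y ⟶ y'} {Q : Pro x' y'} {f' : a ⟶ x'}
    {g' : b ⟶ x'} {h' : c ⟶ y'} {φ : Cell f g A (U x)} {ψ : Cell g h B P} {θ : Cell s t P Q}
    {χ : Cell f' g' A (U x')} {χ' : Cell g' h' B Q} {p : f ≫ s = f'} {q : g ≫ s = g'}
    {r : h ≫ t = h'} (e : vcomp φ (unitCell s) p q = χ) (e' : vcomp ψ θ q r = χ') :
    vcomp (lact φ ψ) θ p r = lact χ χ' := by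
  subst e e'
  rw [lact, lact, post, post, interchange, vcomp_assoc_eq_right (lunit_natural θ).symm,
    vcomp_assoc_eq_left rfl]

theorem lact_unitCell {f : b ⟶ x} (ψ : Cell f h B P) : lact (unitCell f) ψ = lunitHom B ≫ˡ ψ :=
  lunit_natural ψ

theorem assocHom_vcomp_lact_hcomp {d' : D} {k : d ⟶ d'} {C : Pro c d} {Q : Pro y d'}
    (φ : Cell f g A (U x)) (ψ : Cell g h B P) (χ : Cell h k C Q) :
    assocHom A B C ≫ˡ lact φ (hcomp ψ χ) = hcomp (lact φ ψ) χ := by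
  rw [lact, lact, post, post, hcomp_post_left, vcomp_assoc_eq_left (assoc_natural φ ψ χ).symm,
    vcomp_assoc_eq_right (assocHom_vcomp_lunitHom P Q)]

end

section

variable {f : a ⟶ x} {g : b ⟶ y} {h : c ⟶ y} {A : Pro a b} {B : Pro b c} {P : Pro x y}

theorem hcomp_vcomp_ract {f' : a' ⟶ a} {g' : b' ⟶ b} {h' : c' ⟶ c} {A' : Pro a' b'}
    {B' : Pro b' c'} {s : a' ⟶ x} {m : b' ⟶ y} {t : c' ⟶ y} {θ : Cell f' g' A' A}
    {θ' : Cell g' h' B' B} {ψ : Cell f g A P} {φ : Cell g h B (U y)} {χ : Cell s m A' P}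
    {χ' : Cell m t B' (U y)} {p : f' ≫ f = s} {q : g' ≫ g = m} {r : h' ≫ h = t}
    (e : vcomp θ ψ p q = χ) (e' : vcomp θ' φ q r = χ') :
    vcomp (hcomp θ θ') (ract ψ φ) p r = ract χ χ' :=
  hcomp_vcomp_lact (D := HOp D) e' e

theorem ract_vcomp {x' y' : D} {s : x ⟶ x'} {t : y ⟶ y'} {Q : Pro x' y'} {f' : a ⟶ x'}
    {g' : b ⟶ y'} {h' : c ⟶ y'} {ψ : Cell f g A P} {φ : Cell g h B (U y)} {θ : Cell s t P Q}
    {χ : Cell f' g' A Q} {χ' : Cell g' h' B (U y')} {p : f ≫ s = f'} {q : g ≫ t = g'}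
    {r : h ≫ t = h'} (e : vcomp ψ θ p q = χ) (e' : vcomp φ (unitCell t) q r = χ') :
    vcomp (ract ψ φ) θ p r = ract χ χ' :=
  lact_vcomp (D := HOp D) e' e

theorem ract_unitCell (ψ : Cell f g A P) : ract ψ (unitCell g) = runitHom A ≫ˡ ψ :=
  runit_natural ψ

theorem lact_unitCell_right {g : b ⟶ x} (ψ : Cell f g A (U x)) :
    lact ψ (unitCell g) = runitHom A ≫ˡ ψ := by
  rw [lact_eq_ract, ract_unitCell]

theorem assocInv_vcomp_ract_hcomp {z z' : D} {k : z ⟶ z'} {C : Pro z a} {Q : Pro z' x}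
    (χ : Cell k f C Q) (ψ : Cell f g A P) (φ : Cell g h B (U y)) :
    assocInv C A B ≫ˡ ract (hcomp χ ψ) φ = hcomp χ (ract ψ φ) :=
  assocHom_vcomp_lact_hcomp φ.op ψ.op χ.op

end

theorem assocHom_vcomp_hcomp_lact {f : a ⟶ a'} {g : b ⟶ x} {h : c ⟶ x} {k : d ⟶ y} {A : Pro a b}
    {B : Pro b c} {C : Pro c d} {Q : Pro a' x} {P : Pro x y} (φ : Cell f g A Q)
    (ψ : Cell g h B (U x)) (χ : Cell h k C P) :
    assocHom A B C ≫ˡ hcomp φ (lact ψ χ) = hcomp (ract φ ψ) χ := by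
  rw [lact, ract, post, post, hcomp_post_left, hcomp_post_right,
    vcomp_assoc_eq_left (assoc_natural φ ψ χ).symm, vcomp_assoc_eq_right (triangle Q P)]

theorem assocHom_vcomp_lact_lact {f : a ⟶ x} {g : b ⟶ x} {h : c ⟶ x} {k : d ⟶ y} {A : Pro a b}
    {B : Pro b c} {C : Pro c d} {P : Pro x y} (φ : Cell f g A (U x)) (ψ : Cell g h B (U x))
    (χ : Cell h k C P) : assocHom A B C ≫ˡ lact φ (lact ψ χ) = lact (lact φ ψ) χ := by
  rw [lact_eq_ract φ ψ]
  exact vcomp_assoc_eq_left (assocHom_vcomp_hcomp_lact φ ψ χ)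

end UnitAction

section Cartesian

variable {a b a' b' a'' b'' : D} {f : a ⟶ a'} {g : b ⟶ b'} {P : Pro a b} {Q : Pro a' b'}

theorem IsCartesian.existsUnique {φ : Cell f g P Q} (hφ : IsCartesian φ) {x y : D} {h : x ⟶ a}
    {k : y ⟶ b} {s : x ⟶ a'} {t : y ⟶ b'} {R : Pro x y} (χ : Cell s t R Q)
    (p : h ≫ f = s) (q : k ≫ g = t) : ∃! ψ : Cell h k R P, vcomp ψ φ p q = χ := by
  subst p q
  exact hφ h k R χ

theorem IsCartesian.exists_lift {φ : Cell f g P Q} (hφ : IsCartesian φ) {x y : D} {h : x ⟶ a}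
    {k : y ⟶ b} {s : x ⟶ a'} {t : y ⟶ b'} {R : Pro x y} (χ : Cell s t R Q)
    (p : h ≫ f = s) (q : k ≫ g = t) : ∃ ψ : Cell h k R P, vcomp ψ φ p q = χ :=
  (hφ.existsUnique χ p q).exists

theorem IsCartesian.hom_ext {φ : Cell f g P Q} (hφ : IsCartesian φ) {x y : D} {h : x ⟶ a}
    {k : y ⟶ b} {s : x ⟶ a'} {t : y ⟶ b'} {R : Pro x y} {ψ ψ' : Cell h k R P}
    (p : h ≫ f = s) (q : k ≫ g = t) (e : vcomp ψ φ p q = vcomp ψ' φ p q) : ψ = ψ' :=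
  (hφ.existsUnique (vcomp ψ' φ p q) p q).unique e rfl

theorem isCartesian_of_existsUnique {φ : Cell f g P Q}
    (hφ : ∀ {x y : D} {h : x ⟶ a} {k : y ⟶ b} {s : x ⟶ a'} {t : y ⟶ b'} {R : Pro x y}
      (χ : Cell s t R Q) (p : h ≫ f = s) (q : k ≫ g = t),
      ∃! ψ : Cell h k R P, vcomp ψ φ p q = χ) : IsCartesian φ :=
  fun _ _ _ χ => hφ χ rfl rfl

theorem IsCartesian.op {φ : Cell f g P Q} (hφ : IsCartesian φ) :
    IsCartesian (D := HOp D) (f := g) (g := f) φ :=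
  fun h k R χ => hφ k h R χ

theorem IsCartesian.unop {φ : Cell f g P Q}
    (hφ : IsCartesian (D := HOp D) (f := g) (g := f) φ) : IsCartesian φ :=
  fun h k R χ => hφ k h R χ

theorem IsEquipment.op (hD : IsEquipment D) : IsEquipment (HOp D) := fun f g Q =>
  let ⟨P, φ, hφ⟩ := hD (a := _) g f (Q : Pro (D := D) _ _)
  ⟨P, φ, IsCartesian.op hφ⟩

variable {f' : a' ⟶ a''} {g' : b' ⟶ b''} {T : Pro a'' b''} {h : a ⟶ a''} {k : b ⟶ b''}

theorem IsCartesian.comp {φ : Cell f g P Q} {ψ : Cell f' g' Q T} (hφ : IsCartesian φ)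
    (hψ : IsCartesian ψ) (p : f ≫ f' = h) (q : g ≫ g' = k) : IsCartesian (vcomp φ ψ p q) := by
  subst p q
  intro x y h k R χ
  obtain ⟨χ₁, e₁⟩ := hψ.exists_lift χ (assoc h f f') (assoc k g g')
  obtain ⟨χ₂, e₂⟩ := hφ.exists_lift χ₁ rfl rfl
  refine ⟨χ₂, (vcomp_assoc_eq_left e₂).trans e₁, fun χ' e => ?_⟩
  refine hφ.hom_ext rfl rfl (hψ.hom_ext (assoc h f f') (assoc k g g') ?_)
  rw [e₂, e₁, ← vcomp_assoc_eq_left rfl]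
  exact e

theorem IsCartesian.of_comp_of_injective {φ : Cell f g P Q} {ψ : Cell f' g' Q T} {p : f ≫ f' = h}
    {q : g ≫ g' = k} (hφ : IsCartesian (vcomp φ ψ p q))
    (hψ : ∀ {x y : D} {s : x ⟶ a} {t : y ⟶ b} {R : Pro x y} (χ χ' : Cell (s ≫ f) (t ≫ g) R Q),
      vcomp χ ψ rfl rfl = vcomp χ' ψ rfl rfl → χ = χ') : IsCartesian φ := by
  subst p q
  intro x y s t R χ
  obtain ⟨χ₁, e₁⟩ := hφ.exists_lift (vcomp χ ψ rfl rfl) (assoc s f f').symm (assoc t g g').symm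
  refine ⟨χ₁, hψ _ _ ((vcomp_assoc_eq_left rfl).symm.trans e₁), fun χ' e => ?_⟩
  refine hφ.hom_ext (assoc s f f').symm (assoc t g g').symm ?_
  rw [e₁, vcomp_assoc_eq_left e]

theorem IsCartesian.of_comp {φ : Cell f g P Q} {ψ : Cell f' g' Q T} (hψ : IsCartesian ψ)
    {p : f ≫ f' = h} {q : g ≫ g' = k} (hφ : IsCartesian (vcomp φ ψ p q)) : IsCartesian φ :=
  hφ.of_comp_of_injective fun _ _ e => hψ.hom_ext rfl rfl e

theorem isCartesian_of_isIso {P' : Pro a b} (θ : P ⟶ P') [IsIso θ] :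
    IsCartesian (f := 𝟙 a) (g := 𝟙 b) θ := by
  refine isCartesian_of_existsUnique fun {x y h k s t R} χ p q => ?_
  obtain rfl : h = s := (comp_id h).symm.trans p
  obtain rfl : k = t := (comp_id k).symm.trans q
  refine ⟨post χ (inv θ), ?_, fun ψ e => ?_⟩
  · exact (vcomp_assoc_eq_right (IsIso.inv_hom_id θ)).trans (vcomp_id χ)
  · rw [← e]
    exact ((vcomp_assoc_eq_right (IsIso.hom_inv_id θ)).trans (vcomp_id ψ)).symm

theorem IsCartesian.pre_iso {P' : Pro a b} {φ : Cell f g P Q} (hφ : IsCartesian φ) (θ : P' ⟶ P)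
    [IsIso θ] : IsCartesian (vcomp θ φ (id_comp f) (id_comp g)) :=
  IsCartesian.comp (isCartesian_of_isIso θ) hφ _ _

theorem IsCartesian.exists_iso {P' : Pro a b} {φ : Cell f g P Q} {φ' : Cell f g P' Q}
    (hφ : IsCartesian φ) (hφ' : IsCartesian φ') :
    ∃ e : P ≅ P', vcomp e.hom φ' (id_comp f) (id_comp g) = φ ∧
      vcomp e.inv φ (id_comp f) (id_comp g) = φ' := by
  obtain ⟨s, hs⟩ := hφ'.exists_lift φ (id_comp f) (id_comp g)
  obtain ⟨t, ht⟩ := hφ.exists_lift φ' (id_comp f) (id_comp g)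
  refine ⟨⟨s, t, hφ.hom_ext (id_comp f) (id_comp g) ?_,
    hφ'.hom_ext (id_comp f) (id_comp g) ?_⟩, hs, ht⟩
  · exact (vcomp_assoc_eq_right ht).trans (hs.trans (id_vcomp φ).symm)
  · exact (vcomp_assoc_eq_right hs).trans (ht.trans (id_vcomp φ').symm)

theorem IsCartesian.existsUnique_of_isIso [IsIso f] [IsIso g] {φ : Cell f g P Q}
    (hφ : IsCartesian φ) {s : a ⟶ a''} {t : b ⟶ b''} {s' : a' ⟶ a''} {t' : b' ⟶ b''}
    (χ : Cell s t P T) (p : f ≫ s' = s) (q : g ≫ t' = t) :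
    ∃! ψ : Cell s' t' Q T, vcomp φ ψ p q = χ := by
  obtain ⟨ρ, hρ⟩ := hφ.exists_lift (idCell Q) (IsIso.inv_hom_id f) (IsIso.inv_hom_id g)
  have hφρ : vcomp φ ρ (IsIso.hom_inv_id f) (IsIso.hom_inv_id g) = idCell P :=
    hφ.hom_ext (id_comp f) (id_comp g) <| by
      rw [vcomp_assoc_eq_right hρ, vcomp_id, id_vcomp]
  refine ⟨vcomp ρ χ (by simp [← p]) (by simp [← q]), ?_, fun ψ e => ?_⟩
  · exact (vcomp_assoc_eq_left hφρ).trans (id_vcomp χ)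
  · rw [← e, vcomp_assoc_eq_left hρ, id_vcomp]

end Cartesian

section Companion

variable {c q : D} {i : c ⟶ q} {X : Pro c q}

/-- The cells `u` and `α` exhibit `X` as the companion of `i`, i.e. they satisfy the two triangle
identities; the second one is stated with unitors on one side only. -/
structure IsCompanionPair (u : Cell (𝟙 c) i (U c) X) (α : Cell i (𝟙 q) X (U q)) : Prop where
  vcomp_eq : vcomp u α (id_comp i) (comp_id i) = unitCell i
  ract_eq : ract u α = lunitHom X

theorem IsCartesian.exists_isCompanionPair {α : Cell i (𝟙 q) X (U q)} (hα : IsCartesian α) :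
    ∃ u, IsCompanionPair u α := by
  obtain ⟨u, hu⟩ := hα.exists_lift (unitCell i) (id_comp i) (comp_id i)
  refine ⟨u, hu, hα.hom_ext (id_comp i) (comp_id _) ?_⟩
  rw [ract_vcomp hu (vcomp_unitCell_id α), ← lact_eq_ract, lact_unitCell]

variable {u : Cell (𝟙 c) i (U c) X} {α : Cell i (𝟙 q) X (U q)} {b x y : D}

theorem IsCompanionPair.hom_ext (h : IsCompanionPair u α) {s : c ⟶ x} {t : q ⟶ y} {k : c ⟶ y}
    {R : Pro x y} {θ θ' : Cell s t X R} {p : i ≫ t = k}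
    (e : vcomp u θ (id_comp s) p = vcomp u θ' (id_comp s) p) : θ = θ' := by
  refine vcomp_left_cancel (lunit_inv_hom X) ?_
  rw [← h.ract_eq, ract_vcomp e rfl, ract_vcomp rfl rfl]

theorem IsCompanionPair.pcomp_hom_ext (h : IsCompanionPair u α) {A : Pro b c} {s : b ⟶ x}
    {t : q ⟶ y} {k : c ⟶ y} {R : Pro x y} {θ θ' : Cell s t (pcomp A X) R} {p : i ≫ t = k}
    (e : vcomp (hcomp (idCell A) u) θ (id_comp s) p =
      vcomp (hcomp (idCell A) u) θ' (id_comp s) p) : θ = θ' := by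
  have hinv : hcomp (idCell A) (lunitInv X) ≫ˡ hcomp (idCell A) (lunitHom X) = idCell _ := by
    rw [← interchange (q := comp_id _), vcomp_id, lunit_inv_hom, hcomp_id]
  refine vcomp_left_cancel hinv ?_
  rw [← h.ract_eq, ← assocInv_vcomp_ract_hcomp,
    vcomp_assoc_eq_right (ract_vcomp (r := id_comp t) e rfl),
    vcomp_assoc_eq_right (ract_vcomp (r := id_comp t) rfl rfl)]

theorem IsCompanionPair.lact_right_cancel (h : IsCompanionPair u α) {s : x ⟶ q} {A : Pro x c}
    {φ ψ : Cell s i A (U q)} (e : lact φ α = lact ψ α) : φ = ψ := by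
  refine vcomp_left_cancel (runit_inv_hom A) ?_
  rw [← lact_unitCell_right, ← lact_unitCell_right, ← hcomp_vcomp_lact (id_vcomp φ) h.vcomp_eq,
    ← hcomp_vcomp_lact (id_vcomp ψ) h.vcomp_eq, e]

theorem IsCompanionPair.hcomp_lact_idCell (h : IsCompanionPair u α) (P : Pro q x) :
    hcomp u (lact α (idCell P)) = lunitHom (pcomp X P) := by
  refine vcomp_left_cancel (assoc_inv_hom _ _ _) ?_
  rw [assocHom_vcomp_hcomp_lact, h.ract_eq, assocHom_vcomp_lunitHom]

theorem IsCompanionPair.isCartesian_lact_idCell (hu : IsCompanionPair u α) (P : Pro q x) :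
    IsCartesian (lact α (idCell P)) := by
  refine isCartesian_of_existsUnique fun {_ _ h k s t R} χ p r => ?_
  obtain rfl : k = t := (comp_id k).symm.trans r
  have hα' : vcomp (vcomp (unitCell h) u (comp_id h) p) α p (comp_id s) = unitCell s := by
    rw [vcomp_assoc_eq_right hu.vcomp_eq, unitCell_vcomp_unitCell]
  refine ⟨lunitInv R ≫ˡ hcomp (vcomp (unitCell h) u (comp_id h) p) χ, ?_, fun ψ e => ?_⟩
  · beta_reduce
    rw [vcomp_assoc_eq_right (hcomp_vcomp_lact hα' (vcomp_id χ)), lact_unitCell,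
      vcomp_assoc_eq_left (lunit_inv_hom R), id_vcomp]
  · refine vcomp_left_cancel (lunit_inv_hom R) ?_
    rw [vcomp_assoc_eq_left (lunit_hom_inv R), id_vcomp, ← e, interchange (q := p),
      hu.hcomp_lact_idCell, lunit_natural]

theorem IsCompanionPair.isCartesian (h : IsCompanionPair u α) : IsCartesian α := by
  have hα : IsCartesian (lact α (idCell (U q))) := h.isCartesian_lact_idCell (U q)
  have e : runitInv X ≫ˡ lact α (idCell (U q)) = α := by
    rw [← unitCell_id, lact_unitCell_right, vcomp_assoc_eq_left (runit_inv_hom X), id_vcomp]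
  have hα' : IsCartesian (runitInv X ≫ˡ lact α (idCell (U q))) :=
    IsCartesian.pre_iso hα (runitIso X).inv
  rwa [e] at hα'

theorem IsCartesian.lact_idCell (hα : IsCartesian α) (P : Pro q x) :
    IsCartesian (lact α (idCell P)) :=
  let ⟨_, hu⟩ := hα.exists_isCompanionPair
  hu.isCartesian_lact_idCell P

end Companion

section Monoid

variable {c x y : D} {M : Mon c} {f : c ⟶ x}

/-- The unit of a monoid, as a cell. -/
def Mon.one (M : Mon c) : Cell (𝟙 c) (𝟙 c) (U c) (Mon.pro M) := M.η

/-- The multiplication of a monoid, as a cell. -/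
def Mon.mul (M : Mon c) : Cell (𝟙 c) (𝟙 c) (pcomp (Mon.pro M) (Mon.pro M)) (Mon.pro M) := M.μ

theorem Mon.hcomp_one_vcomp_mul (M : Mon c) :
    hcomp (idCell (Mon.pro M)) (Mon.one M) ≫ˡ Mon.mul M = runitHom (Mon.pro M) := M.μ_η

theorem Embedding.one_vcomp_cell (F : Embedding M f) : Mon.one M ≫ˡ F.cell = unitCell f := F.unit

theorem Embedding.mul_vcomp_cell (F : Embedding M f) : Mon.mul M ≫ˡ F.cell = lact F.cell F.cell :=
  F.mul

/-- The composite of an embedding with a vertical arrow. -/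
def Embedding.comp (F : Embedding M f) (h : x ⟶ y) {k : c ⟶ y} (e : f ≫ h = k) :
    Embedding M k where
  cell := vcomp F.cell (unitCell h) e e
  unit := (vcomp_assoc_eq_left F.one_vcomp_cell).trans (unitCell_vcomp_unitCell f h e)
  mul := (vcomp_assoc_eq_left F.mul_vcomp_cell).trans (lact_vcomp rfl rfl)

theorem Embedding.factors_comp (F : Embedding M f) (h : x ⟶ y) {k : c ⟶ y} (e : f ≫ h = k) :
    F.Factors (F.comp h e) h := ⟨e, rfl⟩

theorem Embedding.factors_id (F : Embedding M f) : F.Factors F (𝟙 x) :=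
  ⟨comp_id f, vcomp_unitCell_id F.cell⟩

theorem Embedding.Factors.trans {t : D} {g : c ⟶ y} {k : c ⟶ t} {F : Embedding M f}
    {G : Embedding M g} {K : Embedding M k} {h : x ⟶ y} {h' : y ⟶ t} (hG : F.Factors G h)
    (hK : G.Factors K h') : F.Factors K (h ≫ h') := by
  obtain ⟨e, eG⟩ := hG
  obtain ⟨e', eK⟩ := hK
  refine ⟨by rw [← assoc, e, e'], ?_⟩
  rw [← eK, ← eG, vcomp_assoc_eq_right (unitCell_vcomp_unitCell h h' rfl)]

end Monoid

section LeftModule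

variable {c b x y : D} {M : Mon c}

/-- A left module with target `b` over a monoid. -/
abbrev LeftModule (M : Mon c) (b : D) := Bicategory.LMod (B := Hor D) M ⟨b⟩

/-- The underlying proarrow of a left module. -/
abbrev LeftModule.pro (X : LeftModule M b) : Pro c b := X.X

/-- The action of a left module, as a cell. -/
def LeftModule.action (X : LeftModule M b) :
    Cell (𝟙 c) (𝟙 b) (pcomp (Mon.pro M) X.pro) X.pro := X.act

theorem LeftModule.one_vcomp_action (X : LeftModule M b) :
    hcomp (Mon.one M) (idCell X.pro) ≫ˡ X.action = lunitHom X.pro := X.unit_act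

theorem LeftModule.mul_vcomp_action (X : LeftModule M b) :
    hcomp (Mon.mul M) (idCell X.pro) ≫ˡ X.action =
      assocHom _ _ _ ≫ˡ (hcomp (idCell (Mon.pro M)) X.action ≫ˡ X.action) := X.mul_act

/-- The left module `X ⊙ Y`; it is the value of `X.extend` at `Y`. -/
abbrev LeftModule.pcomp (X : LeftModule M b) (Y : Pro b x) : LeftModule M x where
  X := DoubleCategory.pcomp X.pro Y
  act := assocInv _ _ _ ≫ˡ hcomp X.action (idCell Y)
  unit_act := ((Bicategory.LMod.extend X ⟨x⟩).obj Y).unit_act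
  mul_act := ((Bicategory.LMod.extend X ⟨x⟩).obj Y).mul_act

theorem LeftModule.assocHom_vcomp_pcomp_action (X : LeftModule M b) (Y : Pro b x) :
    assocHom _ _ _ ≫ˡ (X.pcomp Y).action = hcomp X.action (idCell Y) :=
  (vcomp_assoc_eq_left (assoc_hom_inv _ _ _)).trans (id_vcomp _)

/-- A monoid as a left module over itself. -/
abbrev Mon.leftModule (M : Mon c) : LeftModule M c := ⟨M.t, M.μ, M.η_μ, M.assoc⟩

/-- The cell `φ` carries the action of `M` on `X` to the action of the unit on its target, along
the cell `F`. -/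
def IsLeftEmbedding {f : c ⟶ x} {g : b ⟶ y} (F : Cell f f (Mon.pro M) (U x)) (X : LeftModule M b)
    {P : Pro x y} (φ : Cell f g X.pro P) : Prop :=
  X.action ≫ˡ φ = lact F φ

variable {f : c ⟶ x} {g : b ⟶ y} {F : Cell f f (Mon.pro M) (U x)} {X : LeftModule M b}
  {P : Pro x y} {φ : Cell f g X.pro P}

theorem IsLeftEmbedding.comp (hφ : IsLeftEmbedding F X φ) {x' y' : D} {h : x ⟶ x'} {k : y ⟶ y'}
    {Q : Pro x' y'} (χ : Cell h k P Q) {s : c ⟶ x'} {t : b ⟶ y'} (p : f ≫ h = s)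
    (r : g ≫ k = t) : IsLeftEmbedding (vcomp F (unitCell h) p p) X (vcomp φ χ p r) := by
  rw [IsLeftEmbedding, vcomp_assoc_eq_left hφ, lact_vcomp rfl rfl]

theorem IsLeftEmbedding.comp_id (hφ : IsLeftEmbedding F X φ) {y' : D} {k : y ⟶ y'} {Q : Pro x y'}
    (χ : Cell (𝟙 x) k P Q) {t : b ⟶ y'} (r : g ≫ k = t) :
    IsLeftEmbedding F X (vcomp φ χ (Category.comp_id f) r) := by
  simpa only [vcomp_unitCell_id] using hφ.comp χ (Category.comp_id f) r

theorem IsLeftEmbedding.of_comp {x' y' : D} {h : x ⟶ x'} {k : y ⟶ y'} {Q : Pro x' y'}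
    {χ : Cell h k P Q} (hχ : IsCartesian χ) {s : c ⟶ x'} {t : b ⟶ y'} {p : f ≫ h = s}
    {r : g ≫ k = t} (hφ : IsLeftEmbedding (vcomp F (unitCell h) p p) X (vcomp φ χ p r)) :
    IsLeftEmbedding F X φ := by
  refine hχ.hom_ext p r ?_
  rw [lact_vcomp (p := p) (q := p) rfl rfl, ← hφ, vcomp_assoc_eq_right rfl]

theorem IsLeftEmbedding.of_comp_id {y' : D} {k : y ⟶ y'} {Q : Pro x y'} {χ : Cell (𝟙 x) k P Q}
    (hχ : IsCartesian χ) {t : b ⟶ y'} {r : g ≫ k = t}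
    (hφ : IsLeftEmbedding F X (vcomp φ χ (Category.comp_id f) r)) : IsLeftEmbedding F X φ :=
  IsLeftEmbedding.of_comp hχ (p := Category.comp_id f) (r := r) (by rwa [vcomp_unitCell_id])

theorem IsLeftEmbedding.precomp (hφ : IsLeftEmbedding F X φ) {X' : LeftModule M b}
    {w : Cell (𝟙 c) (𝟙 b) X'.pro X.pro}
    (hw : X'.action ≫ˡ w = hcomp (idCell (Mon.pro M)) w ≫ˡ X.action) :
    IsLeftEmbedding F X' (w ≫ˡ φ) := by
  rw [IsLeftEmbedding, vcomp_assoc_eq_left hw, vcomp_assoc_eq_right hφ,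
    hcomp_vcomp_lact (id_vcomp F) rfl]

theorem IsLeftEmbedding.equivariant (hφ : IsLeftEmbedding F X φ) (hc : IsCartesian φ)
    {X' : LeftModule M b} {w : Cell (𝟙 c) (𝟙 b) X'.pro X.pro}
    (hw : IsLeftEmbedding F X' (w ≫ˡ φ)) :
    X'.action ≫ˡ w = hcomp (idCell (Mon.pro M)) w ≫ˡ X.action := by
  refine hc.hom_ext (id_comp f) (id_comp g) ?_
  rw [vcomp_assoc_eq_right hφ, hcomp_vcomp_lact (id_vcomp F) rfl, ← hw, vcomp_assoc_eq_right rfl]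

theorem IsLeftEmbedding.hcomp_right (hφ : IsLeftEmbedding F X φ) {d d' : D} {k : d ⟶ d'}
    {Y : Pro b d} {Q : Pro y d'} (ψ : Cell g k Y Q) :
    IsLeftEmbedding F (X.pcomp Y) (hcomp φ ψ) := by
  refine vcomp_left_cancel (assoc_inv_hom _ _ _) ?_
  rw [assocHom_vcomp_lact_hcomp, vcomp_assoc_eq_left (X.assocHom_vcomp_pcomp_action Y),
    ← interchange (q := id_comp g), hφ, id_vcomp]

theorem IsLeftEmbedding.lact_right {g : b ⟶ x} {φ : Cell f g X.pro (U x)}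
    (hφ : IsLeftEmbedding F X φ) {d d' : D} {k : d ⟶ d'} {Y : Pro b d} {Q : Pro x d'}
    (ψ : Cell g k Y Q) : IsLeftEmbedding F (X.pcomp Y) (lact φ ψ) :=
  (hφ.hcomp_right ψ).comp_id (lunitHom Q) (Category.comp_id k)

theorem Embedding.exists_leftModule (hD : IsEquipment D) (F : Embedding M f) (g : b ⟶ y)
    (P : Pro x y) : ∃ (X : LeftModule M b) (φ : Cell f g X.pro P),
      IsCartesian φ ∧ IsLeftEmbedding F.cell X φ := by
  obtain ⟨X, φ, hφ⟩ := hD f g P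
  obtain ⟨l, hl⟩ := hφ.exists_lift (lact F.cell φ) (id_comp f) (id_comp g)
  refine ⟨⟨X, l, hφ.hom_ext (id_comp f) (id_comp g) ?_, hφ.hom_ext (id_comp f) (id_comp g) ?_⟩,
    φ, hφ, hl⟩
  · exact (vcomp_assoc_eq_right hl).trans
      ((hcomp_vcomp_lact F.one_vcomp_cell (id_vcomp φ)).trans (lact_unitCell φ))
  · calc
      _ = hcomp (Mon.mul M) (idCell X) ≫ˡ lact F.cell φ := vcomp_assoc_eq_right hl
      _ = lact (lact F.cell F.cell) φ := hcomp_vcomp_lact F.mul_vcomp_cell (id_vcomp φ)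
      _ = assocHom _ _ _ ≫ˡ lact F.cell (lact F.cell φ) := (assocHom_vcomp_lact_lact ..).symm
      _ = assocHom _ _ _ ≫ˡ (hcomp (idCell (Mon.pro M)) l ≫ˡ lact F.cell φ) :=
        congrArg (assocHom _ _ _ ≫ˡ ·) (hcomp_vcomp_lact (id_vcomp _) hl).symm
      _ = _ := (vcomp_assoc_eq_right (p₂₃ := id_comp f) (q₂₃ := id_comp g)
        (vcomp_assoc_eq_right hl)).symm

end LeftModule

section LeftUniversal

variable {c q b : D} {M : Mon c} {i : c ⟶ q}

/-- The cell `ι` is universal for left modules: every left module is the restriction along `i` of a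
proarrow out of `q`, and such a cartesian cell is initial among the left embeddings along `ι`.
This expresses that `q` is a Kleisli object of `M` without mentioning the restriction of `U q`. -/
structure LeftUniversal (ι : Cell i i (Mon.pro M) (U q)) : Prop where
  exists_cartesian : ∀ {b : D} (X : LeftModule M b),
    ∃ (Y : Pro q b) (φ : Cell i (𝟙 b) X.pro Y), IsCartesian φ ∧ IsLeftEmbedding ι X φ
  existsUnique : ∀ {b : D} {X : LeftModule M b} {Y : Pro q b} {φ : Cell i (𝟙 b) X.pro Y},
    IsCartesian φ → IsLeftEmbedding ι X φ → ∀ {Z : Pro q b} {χ : Cell i (𝟙 b) X.pro Z},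
      IsLeftEmbedding ι X χ → ∃! ψ : Cell (𝟙 q) (𝟙 b) Y Z, φ ≫ʳ ψ = χ

variable {ι : Cell i i (Mon.pro M) (U q)} {X : LeftModule M b}

theorem LeftUniversal.existsUnique_frames (hD : IsEquipment D) (hι : LeftUniversal ι)
    {Y : Pro q b} {φ : Cell i (𝟙 b) X.pro Y} (hφ : IsCartesian φ) (hφ' : IsLeftEmbedding ι X φ)
    {x y : D} {h : q ⟶ x} {k : b ⟶ y} {f : c ⟶ x} {Z : Pro x y} (p : i ≫ h = f)
    {χ : Cell f k X.pro Z} (hχ : IsLeftEmbedding (vcomp ι (unitCell h) p p) X χ) :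
    ∃! ψ : Cell h k Y Z, vcomp φ ψ p (id_comp k) = χ := by
  obtain ⟨Z', ζ, hζ⟩ := hD h k Z
  obtain ⟨χ', rfl⟩ := hζ.exists_lift χ p (id_comp k)
  obtain ⟨ψ, hψ, hψ'⟩ := hι.existsUnique hφ hφ' (hχ.of_comp hζ)
  refine ⟨vcomp ψ ζ (id_comp h) (id_comp k), vcomp_assoc_eq_left hψ, fun θ hθ => ?_⟩
  obtain ⟨θ', rfl⟩ := hζ.exists_lift θ (id_comp h) (id_comp k)
  rw [hψ' θ' (hζ.hom_ext p (id_comp k) ?_)]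
  rw [← hθ, vcomp_assoc_eq_right rfl]

variable {L : LeftModule M q} {α : Cell i (𝟙 q) L.pro (U q)}

theorem lact_idCell_vcomp {X : Pro c q} (α : Cell i (𝟙 q) X (U q)) {Y Z : Pro q b}
    (ψ : Cell (𝟙 q) (𝟙 b) Y Z) :
    lact α (idCell Y) ≫ʳ ψ = hcomp (idCell X) ψ ≫ˡ lact α (idCell Z) := by
  rw [lact_vcomp (vcomp_unitCell_id α) (id_vcomp ψ),
    hcomp_vcomp_lact (id_vcomp α) (vcomp_id ψ)]

theorem IsLeftEmbedding.exists_iso {X' : LeftModule M b} {Y : Pro q b}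
    {φ : Cell i (𝟙 b) X.pro Y} {φ' : Cell i (𝟙 b) X'.pro Y} (hφ : IsLeftEmbedding ι X φ)
    (hc : IsCartesian φ) (hφ' : IsLeftEmbedding ι X' φ') (hc' : IsCartesian φ') :
    ∃ e : X ≅ X', vcomp e.hom.hom φ' (id_comp i) (id_comp _) = φ := by
  obtain ⟨e, he, he'⟩ := hc.exists_iso hc'
  exact ⟨⟨⟨e.hom, hφ'.equivariant hc' (he ▸ hφ)⟩,
    ⟨e.inv, hφ.equivariant hc (he' ▸ hφ')⟩,
    Bicategory.LMod.Hom.ext e.hom_inv_id, Bicategory.LMod.Hom.ext e.inv_hom_id⟩, he⟩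

theorem LeftUniversal.of_isUniversal (hα : IsCartesian α) (hL : IsLeftEmbedding ι L α)
    (hU : L.IsUniversal) : LeftUniversal ι where
  exists_cartesian {b} X := by
    have := (hU ⟨b⟩).essSurj
    let e := (L.extend ⟨b⟩).objObjPreimageIso X
    let Y : Pro q b := (L.extend ⟨b⟩).objPreimage X
    let θ : X.pro ⟶ pcomp L.pro Y := e.inv.hom
    have : IsIso θ := ⟨e.hom.hom, congrArg Bicategory.LMod.Hom.hom e.inv_hom_id,
      congrArg Bicategory.LMod.Hom.hom e.hom_inv_id⟩
    exact ⟨Y, θ ≫ˡ lact α (idCell Y), IsCartesian.pre_iso (hα.lact_idCell Y) θ,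
      (hL.lact_right (idCell Y)).precomp e.inv.comm⟩
  existsUnique {b X Y φ} hφ hφ' {Z χ} hχ := by
    have := (hU ⟨b⟩).full
    have := (hU ⟨b⟩).faithful
    have hZ : IsCartesian (lact α (idCell Z)) := hα.lact_idCell Z
    obtain ⟨e, he⟩ := (hL.lact_right (idCell Y)).exists_iso (hα.lact_idCell Y) hφ' hφ
    obtain ⟨χ', rfl⟩ := hZ.exists_lift χ (id_comp i) (id_comp _)
    let χ₁ : X ⟶ (L.extend ⟨b⟩).obj Z := ⟨χ', (hL.lact_right (idCell Z)).equivariant hZ hχ⟩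
    obtain ⟨ψ, hψ⟩ := (L.extend ⟨b⟩).map_surjective (e.hom ≫ χ₁)
    have hψ' : hcomp (idCell L.pro) ψ = e.hom.hom ≫ˡ χ' := congrArg Bicategory.LMod.Hom.hom hψ
    have key (θ : Cell (𝟙 q) (𝟙 b) Y Z) :
        e.hom.hom ≫ˡ (φ ≫ʳ θ) = hcomp (idCell L.pro) θ ≫ˡ lact α (idCell Z) :=
      (vcomp_assoc_eq_left he).trans (lact_idCell_vcomp α θ)
    refine ⟨ψ, ?_, fun θ hθ => ?_⟩
    · refine vcomp_left_cancel (congrArg Bicategory.LMod.Hom.hom e.inv_hom_id) ?_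
      rw [key, hψ', vcomp_assoc_eq_right rfl]
    · refine (L.extend ⟨b⟩).map_injective (Bicategory.LMod.Hom.ext ?_)
      refine hZ.hom_ext (id_comp i) (id_comp _) ((key θ).symm.trans ?_)
      rw [hθ, vcomp_assoc_eq_left hψ'.symm]
      rfl

theorem LeftUniversal.isUniversal (hα : IsCartesian α) (hL : IsLeftEmbedding ι L α)
    (hι : LeftUniversal ι) : L.IsUniversal := by
  rintro ⟨b⟩
  have hc (Y : Pro q b) : IsCartesian (lact α (idCell Y)) := hα.lact_idCell Y
  have he (Y : Pro q b) : IsLeftEmbedding ι (L.pcomp Y) (lact α (idCell Y)) :=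
    hL.lact_right (idCell Y)
  refine ⟨⟨fun {Y Z} θ θ' h => ?_⟩, ⟨fun {Y Z} w => ?_⟩, ⟨fun X => ?_⟩⟩
  · have h' : hcomp (idCell L.pro) θ = hcomp (idCell L.pro) θ' :=
      congrArg Bicategory.LMod.Hom.hom h
    refine (hι.existsUnique (hc Y) (he Y) ((he Y).comp_id θ (Category.comp_id _))).unique rfl ?_
    rw [lact_idCell_vcomp, lact_idCell_vcomp, h']
  · obtain ⟨ψ, hψ, -⟩ := hι.existsUnique (hc Y) (he Y) ((he Z).precomp w.comm)
    exact ⟨ψ, Bicategory.LMod.Hom.ext (IsCartesian.hom_ext (hc Z) (id_comp i) (id_comp _)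
      ((lact_idCell_vcomp α ψ).symm.trans hψ))⟩
  · obtain ⟨Y, φ, hφ, hφ'⟩ := hι.exists_cartesian X
    obtain ⟨e, -⟩ := (he Y).exists_iso (hc Y) hφ' hφ
    exact ⟨Y, ⟨e⟩⟩

end LeftUniversal

section RightUniversal

variable {c b q x : D} {N : Mon c} {f : c ⟶ x}

/-- A monoid, regarded as a monoid in the horizontal opposite. -/
abbrev Mon.op (N : Mon c) : Mon (D := HOp D) c where
  t := N.t
  η := N.η
  μ := N.μ
  η_μ := N.μ_η
  μ_η := N.η_μ
  assoc := (Bicategory.Bimodule.unit N).r_mul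

/-- A right module with source `b` over a monoid. -/
abbrev RightModule (N : Mon c) (b : D) := Bicategory.RMod (B := Hor D) N ⟨b⟩

/-- The underlying proarrow of a right module. -/
abbrev RightModule.pro (X : RightModule N b) : Pro b c := X.X

/-- The action of a right module, as a cell. -/
def RightModule.action (X : RightModule N b) :
    Cell (𝟙 b) (𝟙 c) (pcomp X.pro (Mon.pro N)) X.pro := X.act

theorem RightModule.one_vcomp_action (X : RightModule N b) :
    hcomp (idCell X.pro) (Mon.one N) ≫ˡ X.action = runitHom X.pro := X.act_unit

theorem RightModule.mul_vcomp_action (X : RightModule N b) :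
    hcomp (idCell X.pro) (Mon.mul N) ≫ˡ X.action =
      assocInv _ _ _ ≫ˡ (hcomp X.action (idCell (Mon.pro N)) ≫ˡ X.action) := X.act_mul

/-- A right module, regarded as a left module in the horizontal opposite. -/
abbrev RightModule.op (X : RightModule N b) : LeftModule (D := HOp D) (Mon.op N) b where
  X := X.X
  act := X.act
  unit_act := X.act_unit
  mul_act := X.act_mul

/-- Right modules and left modules in the horizontal opposite form equivalent categories. -/
def RightModule.opEquivalence (N : Mon c) (b : D) :
    RightModule N b ≌ LeftModule (D := HOp D) (Mon.op N) b where
  functor :=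
    { obj X := X.op
      map φ := ⟨φ.hom, φ.comm⟩ }
  inverse :=
    { obj X := ⟨X.X, X.act, X.unit_act, X.mul_act⟩
      map φ := ⟨φ.hom, φ.comm⟩ }
  unitIso := Iso.refl _
  counitIso := Iso.refl _

/-- An embedding, regarded as an embedding in the horizontal opposite. -/
abbrev Embedding.op (F : Embedding N f) : Embedding (D := HOp D) (Mon.op N) f where
  cell := F.cell
  unit := F.unit
  mul := F.mul.trans (lact_eq_ract F.cell F.cell)

/-- A left module in the horizontal opposite, regarded as a right module. -/
abbrev LeftModule.unop (X : LeftModule (D := HOp D) (Mon.op N) b) : RightModule N b :=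
  (RightModule.opEquivalence N b).inverse.obj X

theorem RightModule.isUniversal_iff_op (R : RightModule N q) :
    R.IsUniversal ↔ Bicategory.LMod.IsUniversal R.op := by
  have h (b : D) : (R.extend ⟨b⟩).IsEquivalence ↔ (R.op.extend ⟨b⟩).IsEquivalence := by
    change _ ↔ (R.extend ⟨b⟩ ⋙ (opEquivalence N b).functor).IsEquivalence
    exact ⟨fun _ => inferInstance,
      fun _ => Functor.isEquivalence_of_comp_right _ (opEquivalence N b).functor⟩
  exact ⟨fun hR ⟨b⟩ => (h b).1 (hR ⟨b⟩), fun hR ⟨b⟩ => (h b).2 (hR ⟨b⟩)⟩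

end RightUniversal

section Representable

variable {c d : D} {M : Mon c} {X : LeftModule M d} {g : c ⟶ d} {ξ : Cell g (𝟙 d) X.pro (U d)}

theorem IsLeftEmbedding.cell_unique (hξ : IsCartesian ξ) {γ γ' : Cell g g (Mon.pro M) (U d)}
    (h : IsLeftEmbedding γ X ξ) (h' : IsLeftEmbedding γ' X ξ) : γ = γ' := by
  obtain ⟨u, hu⟩ := hξ.exists_isCompanionPair
  exact hu.lact_right_cancel (h.symm.trans h')

theorem LeftModule.exists_isLeftEmbedding (hξ : IsCartesian ξ) :
    ∃ γ : Cell g g (Mon.pro M) (U d), IsLeftEmbedding γ X ξ := by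
  obtain ⟨u, hu⟩ := hξ.exists_isCompanionPair
  refine ⟨runitInv _ ≫ˡ vcomp (hcomp (idCell _) u) (X.action ≫ˡ ξ) (id_comp g) (comp_id g),
    hu.pcomp_hom_ext (p := comp_id g) ?_⟩
  rw [hcomp_vcomp_lact (id_vcomp _) hu.vcomp_eq, lact_unitCell_right,
    vcomp_assoc_eq_left (runit_hom_inv _), id_vcomp]

theorem LeftModule.exists_embedding (hξ : IsCartesian ξ) :
    ∃ F : Embedding M g, IsLeftEmbedding F.cell X ξ := by
  obtain ⟨u, hu⟩ := hξ.exists_isCompanionPair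
  obtain ⟨γ, hγ⟩ := exists_isLeftEmbedding (X := X) hξ
  refine ⟨⟨γ, hu.lact_right_cancel ?_, hu.lact_right_cancel ?_⟩, hγ⟩
  · calc
      _ = hcomp (Mon.one M) (idCell X.pro) ≫ˡ lact γ ξ :=
        (hcomp_vcomp_lact rfl (id_vcomp ξ)).symm
      _ = lunitHom X.pro ≫ˡ ξ := by
        rw [← hγ, vcomp_assoc_eq_left X.one_vcomp_action]
      _ = lact (unitCell g) ξ := (lact_unitCell ξ).symm
  · calc
      _ = hcomp (Mon.mul M) (idCell X.pro) ≫ˡ lact γ ξ :=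
        (hcomp_vcomp_lact rfl (id_vcomp ξ)).symm
      _ = assocHom _ _ _ ≫ˡ (hcomp (idCell _) X.action ≫ˡ (X.action ≫ˡ ξ)) := by
        rw [← hγ, vcomp_assoc_eq_left X.mul_vcomp_action,
          vcomp_assoc_eq_right (p₂₃ := id_comp g) (q₂₃ := id_comp _) (vcomp_assoc_eq_right rfl)]
      _ = assocHom _ _ _ ≫ˡ lact γ (lact γ ξ) := by
        rw [hγ, hcomp_vcomp_lact (id_vcomp γ) hγ]
      _ = lact (lact γ γ) ξ := assocHom_vcomp_lact_lact ..

end Representable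

section Trivial

variable {b c x : D} {M : Mon c}

/-- The trivial monoid on an object; its left and right actions on a proarrow are the unitors. -/
abbrev Mon.triv (b : D) : Mon b where
  t := 𝟙 (⟨b⟩ : Hor D)
  η := 𝟙 _
  μ := (λ_ (𝟙 (⟨b⟩ : Hor D))).hom
  η_μ := by simp
  μ_η := by simp [Bicategory.unitors_equal]
  assoc := by simp [Bicategory.unitors_equal]

/-- A left module, regarded as a bimodule with trivial right action. -/
abbrev LeftModule.toBimod (X : LeftModule M b) : Bimod M (Mon.triv b) where
  X := X.X
  l := X.act
  r := (ρ_ X.X).hom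
  unit_l := X.unit_act
  mul_l := X.mul_act
  r_unit := by simp
  r_mul := by simp
  l_r := by simp

/-- A right module, regarded as a bimodule with trivial left action. -/
abbrev RightModule.toBimod (X : RightModule M b) : Bimod (Mon.triv b) M where
  X := X.X
  l := (λ_ X.X).hom
  r := X.act
  unit_l := by simp
  mul_l := by
    simp only [Bicategory.unitors_equal, Bicategory.triangle_assoc]
  r_unit := X.act_unit
  r_mul := X.act_mul
  l_r := by simp

theorem Embedding.cell_eq_unitCell {g : b ⟶ x} (G : Embedding (Mon.triv b) g) :
    G.cell = unitCell g :=
  (id_vcomp G.cell).symm.trans G.unit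

/-- The embedding of a trivial monoid along a vertical arrow. -/
abbrev Embedding.triv (g : b ⟶ x) : Embedding (Mon.triv b) g where
  cell := unitCell g
  unit := id_vcomp _
  mul := (lact_unitCell (unitCell g)).symm

theorem Embedding.isBimodEmbedding_unit {f : c ⟶ x} (F : Embedding M f) :
    IsBimodEmbedding F F (Bicategory.Bimodule.unit M) F.cell :=
  ⟨F.mul, F.mul.trans (lact_eq_ract F.cell F.cell)⟩

theorem Embedding.triv_isCollapse (b : D) : (Embedding.triv (𝟙 b)).IsCollapse := by
  intro x f F
  refine ⟨f, ⟨id_comp f, ?_⟩, fun h hh => (id_comp h).symm.trans hh.1⟩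
  rw [F.cell_eq_unitCell, unitCell_vcomp_unitCell]

theorem Embedding.triv_isNormalCollapse (b : D) : (Embedding.triv (𝟙 b)).IsNormalCollapse := by
  refine ⟨triv_isCollapse b, triv_isCollapse b, triv_isCollapse b, isBimodEmbedding_unit _, ?_⟩
  rintro x y f g F G Q χ - h k ⟨e₁, -⟩ ⟨e₂, -⟩
  obtain rfl : h = f := (id_comp h).symm.trans e₁
  obtain rfl : k = g := (id_comp k).symm.trans e₂
  simp only [unitCell_id]
  exact ⟨χ, id_vcomp χ, fun ψ hψ => (id_vcomp ψ).symm.trans hψ⟩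

end Trivial

section NormalCollapse

variable {c q x y : D} {M : Mon c} {i : c ⟶ q}

theorem vcomp_eq_of_vcomp_unitCell_eq {a b : D} {s : a ⟶ q} {t : b ⟶ q} {R : Pro a b}
    {χ χ' : Cell s t R (U q)} {h : q ⟶ x} {s' : a ⟶ x} {t' : b ⟶ x} {p : s ≫ h = s'}
    {r : t ≫ h = t'} (e : vcomp χ (unitCell h) p r = vcomp χ' (unitCell h) p r) {k : q ⟶ y}
    {P : Pro x y} (ζ : Cell h k (U q) P) {t'' : b ⟶ y} (r' : t ≫ k = t'') :
    vcomp χ ζ p r' = vcomp χ' ζ p r' := by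
  refine vcomp_left_cancel (runit_inv_hom R) ?_
  rw [vcomp_assoc_eq_left (lact_unitCell_right χ).symm,
    vcomp_assoc_eq_left (lact_unitCell_right χ').symm, lact_vcomp (q := r) e rfl,
    lact_vcomp (q := r) rfl rfl]

/-- The restriction `q(1, i)` inherits the universal property of a normal collapse, since
embedding `M` into it turns left embeddings of `q(1, i)` into bimodule embeddings of `M`. -/
theorem Embedding.IsNormalCollapse.exists_vcomp_eq {I : Embedding M i} (hI : I.IsNormalCollapse)
    {X : LeftModule M q} {α : Cell i (𝟙 q) X.pro (U q)} (hα : IsCartesian α)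
    (hα' : IsLeftEmbedding I.cell X α) {f : c ⟶ x} {F : Embedding M f} {h : q ⟶ x}
    (hF : I.Factors F h) {g : q ⟶ y} {P : Pro x y} {φ : Cell f g X.pro P}
    (hφ : IsLeftEmbedding F.cell X φ) :
    ∃ ζ : Cell h g (U q) P, vcomp α ζ hF.1 (id_comp g) = φ := by
  obtain ⟨a, ha⟩ := hα.exists_lift I.cell (id_comp i) (comp_id i)
  obtain ⟨u, hu⟩ := hα.exists_isCompanionPair
  have one_a : vcomp (Mon.one M) a (id_comp _) (id_comp i) = u :=
    hα.hom_ext (id_comp i) (comp_id i) <| by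
      rw [vcomp_assoc_eq_right ha, hu.vcomp_eq, I.one_vcomp_cell]
  have mul_a : vcomp (Mon.mul M) a (id_comp _) (id_comp i) =
      vcomp (hcomp (idCell _) a) X.action (id_comp _) (comp_id i) :=
    hα.hom_ext (id_comp i) (comp_id i) <| by
      rw [vcomp_assoc_eq_right ha, I.mul_vcomp_cell, vcomp_assoc_eq_right hα',
        hcomp_vcomp_lact (id_vcomp _) ha]
  have mul_a' : vcomp (Mon.mul M) a (id_comp _) (id_comp i) = ract a I.cell :=
    hα.hom_ext (id_comp i) (comp_id i) <| by
      rw [vcomp_assoc_eq_right ha, I.mul_vcomp_cell, ract_vcomp ha (vcomp_unitCell_id _),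
        lact_eq_ract]
  have haφ : IsBimodEmbedding F (I.comp g rfl) (Bicategory.Bimodule.unit M)
      (vcomp a φ (id_comp f) rfl) := by
    refine ⟨(vcomp_assoc_eq_left mul_a).trans ?_, (vcomp_assoc_eq_left mul_a').trans ?_⟩
    · rw [vcomp_assoc_eq_right hφ, hcomp_vcomp_lact (id_vcomp _) rfl]
      rfl
    · exact ract_vcomp rfl rfl
  obtain ⟨ζ, (hζ : vcomp I.cell ζ hF.1 rfl = vcomp a φ (id_comp f) rfl), -⟩ :=
    hI.2.universal F _ _ haφ h g hF (I.factors_comp g rfl)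
  refine ⟨ζ, hu.hom_ext (p := rfl) ?_⟩
  rw [vcomp_assoc_eq_left hu.vcomp_eq, ← one_a, vcomp_assoc_eq_right hζ.symm,
    vcomp_assoc_eq_left I.one_vcomp_cell]

/-- Postcomposition with `unitCell h` is injective on cells whose frames factor through `i`: it
determines the composite with the cell `ζ` below, and `α ≫ ζ` is the cartesian cell `φ` that
exhibits `q(1, i)` as an effective bimodule. -/
theorem IsExact.isKernel (hD : IsEquipment D) (hE : IsExact D) {I : Embedding M i}
    (hI : I.IsNormalCollapse) : I.IsKernel := by
  obtain ⟨X, α, hα, hα'⟩ := I.exists_leftModule hD (𝟙 q) (U q)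
  obtain ⟨x, y, f, g, F, G, P, φ, hF, -, hφ, hφc⟩ := hE.bimodEffective X.toBimod
  obtain ⟨h, hh, -⟩ := hI.1 F
  obtain ⟨ζ, hζ⟩ := hI.exists_vcomp_eq hα hα' hh hφ.left
  obtain ⟨rfl, hhF⟩ := hh
  refine IsCartesian.of_comp_of_injective (hhF ▸ hF) fun {s t _ _ _} χ χ' e => ?_
  have e' := vcomp_eq_of_vcomp_unitCell_eq e ζ rfl
  obtain ⟨θ, rfl⟩ := hα.exists_lift χ rfl (comp_id _)
  obtain ⟨θ', rfl⟩ := hα.exists_lift χ' rfl (comp_id _)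
  rw [vcomp_assoc_eq_right hζ, vcomp_assoc_eq_right hζ] at e'
  rw [IsCartesian.hom_ext hφc _ _ e']

end NormalCollapse

section ExactUniversal

variable {b c d q r : D} {M : Mon c} {N : Mon d} {i : c ⟶ q} {j : d ⟶ r} {I : Embedding M i}
  {J : Embedding N j}

theorem IsExact.exists_bimodEmbedding (hD : IsEquipment D) (hE : IsExact D) (hI : I.IsCollapse)
    (hJ : J.IsCollapse) (B : Bimod M N) :
    ∃ (P : Pro q r) (φ : Cell i j (Bimod.pro B) P), IsCartesian φ ∧ IsBimodEmbedding I J B φ := by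
  obtain ⟨x, y, f, g, F, G, Q, χ, -, -, hχ, hχc⟩ := hE.bimodEffective B
  obtain ⟨h, ⟨rfl, hF⟩, -⟩ := hI F
  obtain ⟨k, ⟨rfl, hG⟩, -⟩ := hJ G
  obtain ⟨P, π, hπ⟩ := hD h k Q
  obtain ⟨φ, rfl⟩ := hπ.exists_lift χ rfl rfl
  refine ⟨P, φ, hπ.of_comp hχc, hπ.hom_ext rfl rfl ?_, hπ.hom_ext rfl rfl ?_⟩
  · exact (vcomp_assoc_eq_right rfl).trans (hχ.left.trans (lact_vcomp hF rfl).symm)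
  · exact (vcomp_assoc_eq_right rfl).trans (hχ.right.trans (ract_vcomp rfl hG).symm)

theorem IsExact.isBimodCollapse (hD : IsEquipment D) (hE : IsExact D) (hI : I.IsNormalCollapse)
    (hJ : J.IsNormalCollapse) {B : Bimod M N} {P : Pro q r} {φ : Cell i j (Bimod.pro B) P}
    (hφ : IsCartesian φ) (hφ' : IsBimodEmbedding I J B φ) : IsBimodCollapse I J B φ :=
  have hI' : I.IsKernel := hE.isKernel hD hI
  have hJ' : J.IsKernel := hE.isKernel hD hJ
  hE.regular.bimodCollapse i j ⟨M, I, hI', hI⟩ ⟨N, J, hJ', hJ⟩ P I J hI' hJ' B φ hφ' hφ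

theorem IsExact.leftUniversal (hD : IsEquipment D) (hE : IsExact D) (hI : I.IsNormalCollapse) :
    LeftUniversal I.cell where
  exists_cartesian {b} X := by
    obtain ⟨P, φ, hφ, hφ'⟩ := hE.exists_bimodEmbedding hD hI.1 (Embedding.triv_isCollapse b)
      X.toBimod
    exact ⟨P, φ, hφ, hφ'.left⟩
  existsUnique {b X Y φ} hφ hφ' {Z χ} hχ :=
    (hE.isBimodCollapse (B := X.toBimod) hD hI (Embedding.triv_isNormalCollapse b) hφ
      ⟨hφ', (ract_unitCell φ).symm⟩).universal I (Embedding.triv (𝟙 b)) χ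
      ⟨hχ, (ract_unitCell χ).symm⟩ (𝟙 q) (𝟙 b) I.factors_id (Embedding.factors_id _)

theorem IsExact.leftUniversal_op (hD : IsEquipment D) (hE : IsExact D) (hI : I.IsNormalCollapse) :
    LeftUniversal I.op.cell where
  exists_cartesian {b} X := by
    obtain ⟨P, φ, hφ, hφ'⟩ := hE.exists_bimodEmbedding hD (Embedding.triv_isCollapse (D := D) b)
      hI.1 (RightModule.toBimod (LeftModule.unop X))
    exact ⟨P, φ, IsCartesian.op hφ, hφ'.right⟩
  existsUnique {b X Y φ} hφ hφ' {Z χ} hχ :=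
    (hE.isBimodCollapse (B := RightModule.toBimod (LeftModule.unop X)) hD
      (Embedding.triv_isNormalCollapse (D := D) b) hI (IsCartesian.unop hφ)
      ⟨(lact_unitCell _).symm, hφ'⟩).universal (Embedding.triv (D := D) (𝟙 b)) I χ
      ⟨(lact_unitCell _).symm, hχ⟩ (𝟙 b) (𝟙 q) (Embedding.factors_id _) I.factors_id

end ExactUniversal

section Kleisli

variable {b c d q : D} {M : Mon c} {i : c ⟶ q} {ι : Cell i i (Mon.pro M) (U q)}
  {X : LeftModule M b}

theorem LeftUniversal.isIso_of_isCartesian (hι : LeftUniversal ι) {Y Z : Pro q b}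
    {φ : Cell i (𝟙 b) X.pro Y} (hφ : IsCartesian φ) (hφ' : IsLeftEmbedding ι X φ) {θ : Y ⟶ Z}
    (hθ : IsCartesian (vcomp φ θ (comp_id i) (comp_id _))) : IsIso θ := by
  have hθ' := hφ'.comp_id θ (Category.comp_id _)
  obtain ⟨t, ht, -⟩ := hι.existsUnique hθ hθ' hφ'
  refine ⟨t, (hι.existsUnique hφ hφ' hφ').unique ?_ (vcomp_id φ),
    (hι.existsUnique hθ hθ' hθ').unique ?_ (vcomp_id _)⟩
  · exact (vcomp_assoc_eq_left rfl).trans ht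
  · exact vcomp_assoc_eq_left ht

variable {L : LeftModule M q} {α : Cell i (𝟙 q) L.pro (U q)}

theorem LeftUniversal.isCartesian_of_restrictCell (hD : IsEquipment D) (hι : LeftUniversal ι)
    (hα : IsCartesian α) (hL : IsLeftEmbedding ι L α) {x y : D} {P : Pro q d} {f : q ⟶ x}
    {k : d ⟶ y} {Q : Pro x y} {ψ : Cell f k P Q} {g : c ⟶ x} {e : i ≫ f = g}
    (hψ : IsCartesian (vcomp (restrictCell α P) ψ e (id_comp k))) : IsCartesian ψ := by
  obtain ⟨P', ψ', hψ'⟩ := hD f k Q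
  obtain ⟨θ, rfl⟩ := hψ'.exists_lift ψ (id_comp f) (id_comp k)
  rw [restrictCell_eq_lact, vcomp_assoc_eq_left (lact_idCell_vcomp α θ),
    vcomp_assoc_eq_right (p₂₃ := e) (q₂₃ := id_comp k) rfl] at hψ
  have hP' : IsCartesian (lact α (idCell P')) := hα.lact_idCell P'
  have h : IsCartesian (vcomp (lact α (idCell P')) ψ' e (id_comp k)) := hP'.comp hψ' e (id_comp k)
  have hθ : IsCartesian (lact α (idCell P) ≫ʳ θ) := by
    rw [lact_idCell_vcomp]
    exact IsCartesian.comp (IsCartesian.of_comp h hψ) hP' _ _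
  have : IsIso (X := P) (Y := P') θ :=
    hι.isIso_of_isCartesian (X := L.pcomp P) (hα.lact_idCell P) (hL.lact_right (idCell P)) hθ
  have hθψ : IsCartesian (θ ≫ˡ ψ') := IsCartesian.pre_iso hψ' θ
  exact @hθψ

/-- The representability clause of `WoodAxiom5`: a representation of `X ⊙ P` by `g` descends to
a representation of `P` by a unique `f` with `f ∘ i = g`. -/
def RepresentationsDescend {X : Pro c q} (α : Cell i (𝟙 q) X (U q)) : Prop :=
  ∀ {d : D} (P : Pro q d) (g : c ⟶ d) (ξ : Cell g (𝟙 d) (pcomp X P) (U d)), Represents ξ →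
    ∃! f : q ⟶ d, ∃ (e : i ≫ f = g) (ψ : Cell f (𝟙 d) P (U d)),
      Represents ψ ∧ vcomp (restrictCell α P) ψ e (comp_id (𝟙 d)) = ξ

theorem LeftUniversal.representationsDescend (hD : IsEquipment D) {I : Embedding M i}
    (hI : I.IsCollapse) (hι : LeftUniversal I.cell) (hα : IsCartesian α)
    (hL : IsLeftEmbedding I.cell L α) : RepresentationsDescend α := by
  intro d P g ξ hξ
  have hP : IsLeftEmbedding I.cell (L.pcomp P) (lact α (idCell P)) := hL.lact_right (idCell P)
  obtain ⟨G, hG⟩ := LeftModule.exists_embedding (X := L.pcomp P) hξ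
  obtain ⟨f, ⟨e, hf⟩, f_unique⟩ := hI G
  obtain ⟨ψ, hψ, -⟩ := hι.existsUnique_frames hD (hα.lact_idCell P) hP e (hf ▸ hG)
  refine ⟨f, ⟨e, ψ, hι.isCartesian_of_restrictCell hD hα hL (e := e) ?_, hψ⟩, ?_⟩
  · exact hψ.symm ▸ hξ
  · rintro f' ⟨e', ψ', -, rfl⟩
    exact f_unique f' ⟨e', IsLeftEmbedding.cell_unique hξ (hP.comp ψ' e' (comp_id _)) hG⟩

end Kleisli

theorem IsExact.woodAxiom5 (hD : IsEquipment D) (hE : IsExact D) : WoodAxiom5 D := by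
  intro c M
  obtain ⟨q, i, I, hI⟩ := hE.regular.collapse M (hE.monEffective M)
  obtain ⟨L, α, hα, hL⟩ := I.exists_leftModule hD (𝟙 q) (U q)
  obtain ⟨R, β, hβ, hR⟩ := I.op.exists_leftModule hD.op (𝟙 q) (U (D := HOp D) q)
  have hι := hE.leftUniversal hD hI
  have represents : RepresentationsDescend α := hι.representationsDescend hD hI.1 hα hL
  refine ⟨q, i, I.cell, L, α, LeftModule.unop R, β, hα, IsCartesian.unop hβ, hL,
    hR.trans (lact_eq_ract (D := D) (g := i) _ _).symm, hι.isUniversal hα hL,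
    (RightModule.isUniversal_iff_op _).2 ((hE.leftUniversal_op hD hI).isUniversal hβ hR),
    fun {d} P => ⟨?_, ?_⟩, represents⟩
  · rintro ⟨f, ψ, hψ⟩
    exact ⟨i ≫ f, vcomp (restrictCell α P) ψ rfl (comp_id _),
      IsCartesian.comp (hα.lact_idCell P) hψ _ _⟩
  · rintro ⟨g, ξ, hξ⟩
    obtain ⟨f, ⟨-, ψ, hψ, -⟩, -⟩ := represents P g ξ hξ
    exact ⟨f, ψ, hψ⟩

section LeftUniversal

variable {b c q x y : D} {M : Mon c} {i : c ⟶ q} {ι : Cell i i (Mon.pro M) (U q)}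

theorem LeftUniversal.vcomp_unitCell (hD : IsEquipment D) (hι : LeftUniversal ι) (h : q ⟶ x)
    [IsIso h] {f : c ⟶ x} (p : i ≫ h = f) : LeftUniversal (vcomp ι (unitCell h) p p) where
  exists_cartesian {b} X := by
    obtain ⟨Y, φ, hφ, hφ'⟩ := hι.exists_cartesian X
    obtain ⟨Y', ρ, hρ⟩ := hD (inv h) (𝟙 b) Y
    have p' : f ≫ inv h = i := by simp [← p]
    obtain ⟨φ', rfl⟩ := hρ.exists_lift φ p' (id_comp _)
    have hinv : vcomp (vcomp ι (unitCell h) p p) (unitCell (inv h)) p' p' = ι := by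
      rw [vcomp_assoc_eq_right (unitCell_vcomp_unitCell h (inv h) (IsIso.hom_inv_id h)),
        vcomp_unitCell_id]
    exact ⟨Y', φ', IsCartesian.of_comp hρ hφ,
      IsLeftEmbedding.of_comp hρ (p := p') (r := id_comp _) (by rwa [hinv])⟩
  existsUnique {b X Y φ} hφ hφ' {Z χ} hχ := by
    obtain ⟨Y', ρ, hρ⟩ := hD h (𝟙 b) Y
    obtain ⟨φ, rfl⟩ := hρ.exists_lift φ p (id_comp _)
    obtain ⟨ψ', hψ', ψ'_unique⟩ :=
      hι.existsUnique_frames hD (IsCartesian.of_comp hρ hφ) (hφ'.of_comp hρ) p hχ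
    obtain ⟨ψ, hψ, ψ_unique⟩ :=
      IsCartesian.existsUnique_of_isIso hρ ψ' (comp_id h) (comp_id (𝟙 b))
    refine ⟨ψ, (vcomp_assoc_eq_right hψ).trans hψ', fun θ hθ => ψ_unique θ (ψ'_unique _ ?_)⟩
    exact (vcomp_assoc_eq_right rfl).symm.trans hθ

variable {L : LeftModule M q} {α : Cell i (𝟙 q) L.pro (U q)}

theorem LeftUniversal.isCollapse (hD : IsEquipment D) {I : Embedding M i}
    (hι : LeftUniversal I.cell) (hα : IsCartesian α) (hL : IsLeftEmbedding I.cell L α)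
    (hrep : RepresentationsDescend α) : I.IsCollapse := by
  intro x f F
  obtain ⟨T, τ, hτ, hFτ⟩ := F.exists_leftModule hD (𝟙 x) (U x)
  obtain ⟨P, φ, hφ, hφ'⟩ := hι.exists_cartesian T
  have hP : IsCartesian (lact α (idCell P)) := hα.lact_idCell P
  have hP' : IsLeftEmbedding I.cell (L.pcomp P) (lact α (idCell P)) := hL.lact_right (idCell P)
  obtain ⟨w, -⟩ := hP'.exists_iso hP hφ' hφ
  have hξ : Represents (w.hom.hom ≫ˡ τ) :=
    have : IsIso w.hom.hom := ⟨w.inv.hom, congrArg Bicategory.LMod.Hom.hom w.hom_inv_id,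
      congrArg Bicategory.LMod.Hom.hom w.inv_hom_id⟩
    IsCartesian.pre_iso hτ w.hom.hom
  have hξ' : IsLeftEmbedding F.cell (L.pcomp P) (w.hom.hom ≫ˡ τ) := hFτ.precomp w.hom.comm
  obtain ⟨h, ⟨e, ψ, -, hψ⟩, h_unique⟩ := hrep P f _ hξ
  refine ⟨h, ⟨e, IsLeftEmbedding.cell_unique hξ ?_ hξ'⟩, ?_⟩
  · exact hψ ▸ hP'.comp ψ e (comp_id _)
  · rintro h' ⟨e', hh'⟩
    obtain ⟨ψ', hψ', -⟩ := hι.existsUnique_frames hD hP hP' e' (hh' ▸ hξ')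
    have hψ'c : IsCartesian ψ' :=
      hι.isCartesian_of_restrictCell hD hα hL (e := e') (hψ'.symm ▸ hξ)
    exact h_unique h' ⟨e', ψ', hψ'c, hψ'⟩

theorem IsCartesian.hcomp_idCell (hD : IsEquipment D) {e : D} {X : Pro c b} {Y : Pro q b}
    {φ : Cell i (𝟙 b) X Y} (hφ : IsCartesian φ) (A : Pro b e) :
    IsCartesian (hcomp φ (idCell A)) := by
  obtain ⟨Z, α, hα⟩ := hD i (𝟙 q) (U q)
  obtain ⟨w, rfl, -⟩ := hφ.exists_iso (hα.lact_idCell Y)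
  have hwA : IsIso (hmap w.hom (𝟙 A)) := ⟨hmap w.inv (𝟙 A), by
    rw [← hmap_comp, w.hom_inv_id, Category.comp_id, hmap_id], by
    rw [← hmap_comp, w.inv_hom_id, Category.comp_id, hmap_id]⟩
  have hYA : IsCartesian (hcomp (lact α (idCell Y)) (idCell A)) := by
    rw [← assocHom_vcomp_lact_hcomp, hcomp_id]
    exact IsCartesian.pre_iso (hα.lact_idCell _) (assocIso Z Y A).hom
  have hw : hcomp (w.hom ≫ˡ lact α (idCell Y)) (idCell A) =
      hmap w.hom (𝟙 A) ≫ˡ hcomp (lact α (idCell Y)) (idCell A) := by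
    change _ = hcomp w.hom (idCell A) ≫ˡ hcomp (lact α (idCell Y)) (idCell A)
    rw [← interchange (q := id_comp _), id_vcomp]
  have h : IsCartesian (hmap w.hom (𝟙 A) ≫ˡ hcomp (lact α (idCell Y)) (idCell A)) :=
    IsCartesian.pre_iso hYA (hmap w.hom (𝟙 A))
  rw [hw]
  exact @h

theorem LeftUniversal.hcomp_hom_ext (hD : IsEquipment D) (hι : LeftUniversal ι) {X : LeftModule M b}
    {Y : Pro q b} {φ : Cell i (𝟙 b) X.pro Y} (hφ : IsCartesian φ) (hφ' : IsLeftEmbedding ι X φ)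
    {e : D} {A : Pro b e} {h : q ⟶ x} {k : e ⟶ y} {Z : Pro x y} {θ θ' : Cell h k (pcomp Y A) Z}
    {s : c ⟶ x} {p : i ≫ h = s}
    (hθ : vcomp (hcomp φ (idCell A)) θ p (id_comp k) =
      vcomp (hcomp φ (idCell A)) θ' p (id_comp k)) : θ = θ' :=
  have hφA : IsLeftEmbedding ι (X.pcomp A) (hcomp φ (idCell A)) := hφ'.hcomp_right (idCell A)
  (hι.existsUnique_frames hD (hφ.hcomp_idCell hD A) hφA p
    (hφA.comp θ p (id_comp k))).unique rfl hθ.symm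

/-- Let `φ : M ⟶ P` be initial among the left embeddings of `M`. The unit of `M` followed by `φ` is
a unit exhibiting `P` as the conjoint of `i`, whose counit is the cell induced by `I.cell`. -/
theorem LeftUniversal.isKernel (hD : IsEquipment D) {I : Embedding M i}
    (hι : LeftUniversal I.cell) : I.IsKernel := by
  obtain ⟨P, φ, hφ, hφ'⟩ := hι.exists_cartesian (Mon.leftModule M)
  have hφ_mul : Mon.mul M ≫ˡ φ = lact I.cell φ := hφ'
  obtain ⟨s, hs, -⟩ := hι.existsUnique_frames (h := 𝟙 q) (k := i) hD hφ hφ' (comp_id i)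
    (χ := I.cell) (by rw [vcomp_unitCell_id]; exact I.mul)
  have one_s : vcomp (Mon.one M ≫ˡ φ) s (comp_id i) (id_comp i) = unitCell i :=
    (vcomp_assoc_eq_right hs).trans I.one_vcomp_cell
  have lact_s : lact s (Mon.one M ≫ˡ φ) = runitHom P := by
    refine hι.hcomp_hom_ext (p := comp_id i) hD hφ hφ' ?_
    rw [hcomp_vcomp_lact hs (id_vcomp _), ← unitCell_id, ← hcomp_vcomp_lact (id_vcomp _) rfl,
      ← hφ_mul, vcomp_assoc_eq_left M.hcomp_one_vcomp_mul]
    exact (runit_natural φ).symm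
  have hP : IsCompanionPair (D := HOp D) (Mon.one M ≫ˡ φ) s := ⟨one_s, lact_s⟩
  have hs' : IsCartesian s := IsCartesian.unop hP.isCartesian
  have hI : IsCartesian (vcomp φ s (comp_id i) (id_comp i)) := IsCartesian.comp hφ hs' _ _
  rwa [hs] at hI

end LeftUniversal

section Bimodule

variable {b c d q r x y : D} {M : Mon c} {N : Mon d} {i : c ⟶ q} {j : d ⟶ r}

/-- The left module underlying a bimodule. -/
abbrev Bimod.left (B : Bimod M N) : LeftModule M d := ⟨B.X, B.l, B.unit_l, B.mul_l⟩

/-- The right module underlying a bimodule. -/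
abbrev Bimod.right (B : Bimod M N) : RightModule N c := ⟨B.X, B.r, B.r_unit, B.r_mul⟩

theorem Bimod.pcomp_action_vcomp_action (B : Bimod M N) :
    (LeftModule.pcomp (Bimod.left B) (Mon.pro N)).action ≫ˡ RightModule.action (Bimod.right B) =
      hcomp (idCell (Mon.pro M)) (RightModule.action (Bimod.right B)) ≫ˡ
        LeftModule.action (Bimod.left B) := by
  refine vcomp_left_cancel (assoc_inv_hom _ _ _) (Eq.trans ?_ B.l_r)
  exact vcomp_assoc_eq_left ((Bimod.left B).assocHom_vcomp_pcomp_action (Mon.pro N))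

theorem LeftUniversal.exists_rightModule (hD : IsEquipment D)
    {ι : Cell i i (Mon.pro M) (U q)} (hι : LeftUniversal ι) (B : Bimod M N) :
    ∃ (Y : RightModule N q) (φ : Cell i (𝟙 d) (Bimod.pro B) Y.pro), IsCartesian φ ∧
      IsLeftEmbedding ι (Bimod.left B) φ ∧
      hcomp φ (idCell (Mon.pro N)) ≫ʳ Y.action = RightModule.action (Bimod.right B) ≫ˡ φ := by
  obtain ⟨Y, φ, hφ, hφ'⟩ := hι.exists_cartesian (Bimod.left B)
  have hφN : IsLeftEmbedding ι (LeftModule.pcomp (Bimod.left B) (Mon.pro N))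
      (hcomp φ (idCell (Mon.pro N))) := hφ'.hcomp_right (idCell _)
  obtain ⟨m, hm, -⟩ := hι.existsUnique (hφ.hcomp_idCell hD (Mon.pro N)) hφN
    (hφ'.precomp (Bimod.pcomp_action_vcomp_action B))
  have one_m : hcomp (idCell Y) (Mon.one N) ≫ˡ m = runitHom Y := by
    refine hι.hcomp_hom_ext (p := comp_id i) hD hφ hφ' ?_
    rw [vcomp_assoc_eq_left (hcomp_idCell_vcomp_hcomp_idCell φ (Mon.one N)),
      vcomp_assoc_eq_right hm, vcomp_assoc_eq_left (RightModule.one_vcomp_action (Bimod.right B)),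
      ← unitCell_id]
    exact (runit_natural φ).symm
  have hφm : hcomp (hcomp φ (idCell (Mon.pro N))) (idCell (Mon.pro N)) ≫ʳ
      hcomp m (idCell (Mon.pro N)) =
      hcomp (RightModule.action (Bimod.right B)) (idCell (Mon.pro N)) ≫ˡ
        hcomp φ (idCell (Mon.pro N)) := by
    rw [← interchange (q := comp_id _), ← interchange (q := comp_id _), hm]
  have mul_m : hcomp (idCell Y) (Mon.mul N) ≫ˡ m =
      assocInv _ _ _ ≫ˡ (hcomp m (idCell (Mon.pro N)) ≫ˡ m) := by
    refine hι.hcomp_hom_ext (p := comp_id i) hD hφ hφ' ?_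
    rw [vcomp_assoc_eq_left (hcomp_idCell_vcomp_hcomp_idCell φ (Mon.mul N)),
      vcomp_assoc_eq_right hm, vcomp_assoc_eq_left (RightModule.mul_vcomp_action (Bimod.right B)),
      ← hcomp_id, vcomp_assoc_eq_left (assoc_inv_natural _ _ _), vcomp_assoc_eq_right
      (p₂₃ := comp_id i) (q₂₃ := comp_id _) ((vcomp_assoc_eq_left hφm).trans
      (vcomp_assoc_eq_right hm))]
    exact vcomp_assoc_eq_right (p₂₃ := id_comp i) (q₂₃ := id_comp _) (vcomp_assoc_eq_right rfl)
  exact ⟨⟨Y, m, one_m, mul_m⟩, φ, hφ, hφ', hm⟩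

variable {I : Embedding M i} {J : Embedding N j}

theorem Embedding.exists_rightModule (hD : IsEquipment D) (J : Embedding N j) (k : b ⟶ x)
    (P : Pro x r) : ∃ (Y : RightModule N b) (π : Cell k j Y.pro P),
      IsCartesian π ∧ Y.action ≫ˡ π = ract π J.cell := by
  obtain ⟨Y, π, hπ, hπJ⟩ := J.op.exists_leftModule hD.op k P
  exact ⟨LeftModule.unop Y, π, IsCartesian.unop hπ, hπJ⟩

theorem LeftUniversal.exists_cartesian_op (hJ : LeftUniversal J.op.cell) (Y : RightModule N b) :
    ∃ (P : Pro b r) (π : Cell (𝟙 b) j Y.pro P),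
      IsCartesian π ∧ Y.action ≫ˡ π = ract π J.cell := by
  obtain ⟨P, π, hπ, hπJ⟩ := hJ.exists_cartesian Y.op
  exact ⟨P, π, IsCartesian.unop hπ, hπJ⟩

theorem LeftUniversal.existsUnique_frames_op (hD : IsEquipment D) (hJ : LeftUniversal J.op.cell)
    {Y : RightModule N b} {P : Pro b r} {π : Cell (𝟙 b) j Y.pro P} (hπ : IsCartesian π)
    (hπJ : Y.action ≫ˡ π = ract π J.cell) {h : b ⟶ x} {k : r ⟶ y} {g : d ⟶ y} {Z : Pro x y}
    (p : j ≫ k = g) {χ : Cell h g Y.pro Z}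
    (hχ : Y.action ≫ˡ χ = ract χ (vcomp J.cell (unitCell k) p p)) :
    ∃! ψ : Cell h k P Z, vcomp π ψ (id_comp h) p = χ :=
  hJ.existsUnique_frames (X := Y.op) hD.op (IsCartesian.op hπ) hπJ p hχ

theorem LeftUniversal.exists_bimodEmbedding (hD : IsEquipment D) (hI : LeftUniversal I.cell)
    (hJ : LeftUniversal J.op.cell) (B : Bimod M N) :
    ∃ (P : Pro q r) (φ : Cell i j (Bimod.pro B) P), IsCartesian φ ∧ IsBimodEmbedding I J B φ := by
  obtain ⟨Y, φ, hφ, hφI, hφN⟩ := hI.exists_rightModule hD B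
  obtain ⟨P, π, hπ, hπJ⟩ := hJ.exists_cartesian_op Y
  refine ⟨P, vcomp φ π (comp_id i) (id_comp j), IsCartesian.comp hφ hπ _ _,
    hφI.comp_id π (id_comp j), ?_⟩
  exact (vcomp_assoc_eq_left hφN.symm).trans ((vcomp_assoc_eq_right hπJ).trans
    (hcomp_vcomp_ract rfl (id_vcomp _)))

theorem IsBimodEmbedding.existsUnique (hD : IsEquipment D) (hI : LeftUniversal I.cell)
    (hJ : LeftUniversal J.op.cell) {B : Bimod M N} {P : Pro q r} {φ : Cell i j (Bimod.pro B) P}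
    (hφ : IsBimodEmbedding I J B φ) (hφc : IsCartesian φ) {f : c ⟶ x} {g : d ⟶ y}
    {F : Embedding M f} {G : Embedding N g} {Q : Pro x y} {χ : Cell f g (Bimod.pro B) Q}
    (hχ : IsBimodEmbedding F G B χ) {h : q ⟶ x} {k : r ⟶ y} (hF : I.Factors F h)
    (hG : J.Factors G k) : ∃! ψ : Cell h k P Q, vcomp φ ψ hF.1 hG.1 = χ := by
  obtain ⟨p, hF⟩ := hF
  obtain ⟨p', hG⟩ := hG
  have hχr : RightModule.action (Bimod.right B) ≫ˡ χ = ract χ G.cell := hχ.right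
  have hφr : RightModule.action (Bimod.right B) ≫ˡ φ = ract φ J.cell := hφ.right
  obtain ⟨Y, π, hπ, hπJ⟩ := J.exists_rightModule hD (𝟙 q) P
  obtain ⟨φ, rfl⟩ := hπ.exists_lift φ (comp_id i) (id_comp j)
  have hφ₀ : IsCartesian φ := IsCartesian.of_comp hπ hφc
  have hφI : IsLeftEmbedding I.cell (Bimod.left B) φ := IsLeftEmbedding.of_comp_id hπ hφ.left
  have hφN : hcomp φ (idCell (Mon.pro N)) ≫ʳ Y.action =
      RightModule.action (Bimod.right B) ≫ˡ φ := by
    refine hπ.hom_ext (comp_id i) (id_comp j) ?_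
    rw [vcomp_assoc_eq_right hπJ, hcomp_vcomp_ract rfl (id_vcomp _), vcomp_assoc_eq_right rfl]
    exact hφr.symm
  have hχI : IsLeftEmbedding (vcomp I.cell (unitCell h) p p) (Bimod.left B) χ := hF ▸ hχ.left
  obtain ⟨χ', hχ', χ'_unique⟩ := hI.existsUnique_frames hD hφ₀ hφI p hχI
  have hχ'J : Y.action ≫ˡ χ' = ract χ' (vcomp J.cell (unitCell k) p' p') := by
    refine hI.hcomp_hom_ext (p := p) hD hφ₀ hφI ?_
    rw [vcomp_assoc_eq_left hφN, vcomp_assoc_eq_right hχ', hcomp_vcomp_ract hχ' (id_vcomp _), hG]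
    exact hχr
  obtain ⟨ψ, hψ, ψ_unique⟩ := hJ.existsUnique_frames_op hD hπ hπJ p' hχ'J
  refine ⟨ψ, (vcomp_assoc_eq_right hψ).trans hχ', fun θ hθ => ψ_unique θ (χ'_unique _ ?_)⟩
  exact (vcomp_assoc_eq_right rfl).symm.trans hθ

end Bimodule

section Collapse

variable {c d q x : D} {f : c ⟶ d}

theorem Embedding.IsKernel.exists_precomp {K K' : Mon c} {F : Embedding K f} {F' : Embedding K' f}
    (hF : F.IsKernel) {t : Cell (𝟙 c) (𝟙 c) (Mon.pro K') (Mon.pro K)}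
    (ht : t ≫ˡ F.cell = F'.cell) {e : c ⟶ x} (E : Embedding K e) :
    ∃ E' : Embedding K' e, E'.cell = t ≫ˡ E.cell := by
  have hF : IsCartesian F.cell := hF
  have one_t : Mon.one K' ≫ˡ t = Mon.one K := by
    refine hF.hom_ext (id_comp f) (id_comp f) ?_
    rw [vcomp_assoc_eq_right ht, F'.one_vcomp_cell, F.one_vcomp_cell]
  have mul_t : Mon.mul K' ≫ˡ t = hcomp t t ≫ˡ Mon.mul K := by
    refine hF.hom_ext (id_comp f) (id_comp f) ?_
    rw [vcomp_assoc_eq_right ht, F'.mul_vcomp_cell, vcomp_assoc_eq_right F.mul_vcomp_cell,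
      hcomp_vcomp_lact ht ht]
  refine ⟨⟨t ≫ˡ E.cell, (vcomp_assoc_eq_left one_t).trans E.one_vcomp_cell, ?_⟩, rfl⟩
  exact (vcomp_assoc_eq_left mul_t).trans
    ((vcomp_assoc_eq_right E.mul_vcomp_cell).trans (hcomp_vcomp_lact rfl rfl))

theorem Embedding.IsKernel.isCollapse {K K' : Mon c} {F : Embedding K f} {F' : Embedding K' f}
    (hF : F.IsKernel) (hF' : F'.IsKernel) (h : F'.IsCollapse) : F.IsCollapse := by
  intro x e E
  obtain ⟨w, hw, hw'⟩ := IsCartesian.exists_iso hF hF'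
  obtain ⟨E', hE'⟩ := hF.exists_precomp hw' E
  have hom_inv : vcomp w.hom w.inv (id_comp (𝟙 c)) (id_comp (𝟙 c)) = idCell (Mon.pro K) :=
    w.hom_inv_id
  have factors_iff (k : d ⟶ x) : F'.Factors E' k ↔ F.Factors E k := by
    constructor <;> rintro ⟨p, hk⟩ <;> refine ⟨p, ?_⟩
    · rw [← hw, vcomp_assoc_eq_right hk, hE', vcomp_assoc_eq_left hom_inv, id_vcomp]
    · rw [← hw', vcomp_assoc_eq_right hk, hE']
  simpa only [factors_iff] using h E'

theorem Embedding.IsCollapse.isIso_of_factors {M : Mon c} {i : c ⟶ q} {I : Embedding M i}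
    {g : c ⟶ x} {F : Embedding M g} (hI : I.IsCollapse) (hF : F.IsCollapse) {h : q ⟶ x}
    (hh : I.Factors F h) : IsIso h := by
  obtain ⟨h', hh', -⟩ := hF I
  exact ⟨h', (hI I).unique (hh.trans hh') I.factors_id, (hF F).unique (hh'.trans hh) F.factors_id⟩

end Collapse

section Wood

variable {c d q r : D} {M : Mon c} {N : Mon d} {i : c ⟶ q} {j : d ⟶ r} {I : Embedding M i}
  {J : Embedding N j}

theorem WoodAxiom5.exists_universal (hD : IsEquipment D) (hW : WoodAxiom5 D) (M : Mon c) :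
    ∃ (q : D) (i : c ⟶ q) (I : Embedding M i),
      I.IsCollapse ∧ LeftUniversal I.cell ∧ LeftUniversal I.op.cell := by
  obtain ⟨q, i, ι, L, α, R, β, hα, hβ, hαL, hβR, hL, hR, -, hrep⟩ := hW M
  obtain ⟨I, hI⟩ : ∃ I : Embedding M i, IsLeftEmbedding I.cell L α :=
    LeftModule.exists_embedding hα
  obtain rfl : I.cell = ι := IsLeftEmbedding.cell_unique hα hI hαL
  have hI' : LeftUniversal I.cell := LeftUniversal.of_isUniversal hα hI hL
  have hR' := (RightModule.isUniversal_iff_op _).1 hR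
  exact ⟨q, i, I, hI'.isCollapse hD hα hI hrep, hI', LeftUniversal.of_isUniversal
    (L := RightModule.op R) (IsCartesian.op hβ) (hβR.trans (lact_eq_ract β I.cell)) hR'⟩

theorem WoodAxiom5.leftUniversal (hD : IsEquipment D) (hW : WoodAxiom5 D) (hI : I.IsCollapse) :
    LeftUniversal I.cell := by
  obtain ⟨q', i', I', hI', hL, -⟩ := hW.exists_universal hD M
  obtain ⟨h, hh, -⟩ := hI' I
  have := hI'.isIso_of_factors hI hh
  exact hh.2 ▸ hL.vcomp_unitCell hD h hh.1

theorem WoodAxiom5.leftUniversal_op (hD : IsEquipment D) (hW : WoodAxiom5 D) (hI : I.IsCollapse) :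
    LeftUniversal I.op.cell := by
  obtain ⟨q', i', I', hI', -, hR⟩ := hW.exists_universal hD M
  obtain ⟨h, hh, -⟩ := hI' I
  have : IsIso (C := HOp D) h := hI'.isIso_of_factors hI hh
  exact hh.2 ▸ hR.vcomp_unitCell hD.op h hh.1

theorem WoodAxiom5.isBimodCollapse (hD : IsEquipment D) (hW : WoodAxiom5 D) (hI : I.IsCollapse)
    (hJ : J.IsCollapse) {B : Bimod M N} {P : Pro q r} {φ : Cell i j (Bimod.pro B) P}
    (hφ : IsBimodEmbedding I J B φ) (hφc : IsCartesian φ) : IsBimodCollapse I J B φ where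
  collapse_left := hI
  collapse_right := hJ
  embedding := hφ
  universal _ _ _ _ hχ _ _ hF hG :=
    hφ.existsUnique hD (hW.leftUniversal hD hI) (hW.leftUniversal_op hD hJ) hφc hχ hF hG

theorem WoodAxiom5.isKernel (hD : IsEquipment D) (hW : WoodAxiom5 D) (hI : I.IsCollapse) :
    I.IsKernel :=
  (hW.leftUniversal hD hI).isKernel hD

theorem WoodAxiom5.isExact (hD : IsEquipment D) (hW : WoodAxiom5 D) : IsExact D where
  regular :=
    { collapse M _ := by
        obtain ⟨q, i, I, hI, -, -⟩ := hW.exists_universal hD M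
        exact ⟨q, i, I, hI, hW.isBimodCollapse hD hI hI I.isBimodEmbedding_unit
          (hW.isKernel hD hI)⟩
      bimodCollapse := by
        rintro c d c' d' f g ⟨_, F', hF', hF'c, -⟩ ⟨_, G', hG', hG'c, -⟩ B K L F G hF hG R φ hφ hφc
        exact hW.isBimodCollapse hD (hF.isCollapse hF' hF'c) (hG.isCollapse hG' hG'c) hφ hφc }
  monEffective M := by
    obtain ⟨q, i, I, hI, -, -⟩ := hW.exists_universal hD M
    exact ⟨q, i, I, hW.isKernel hD hI⟩
  bimodEffective {c d M N} B := by
    obtain ⟨q, i, I, hI, hIl, -⟩ := hW.exists_universal hD M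
    obtain ⟨r, j, J, hJ, -, hJr⟩ := hW.exists_universal hD N
    obtain ⟨P, φ, hφ, hφ'⟩ := hIl.exists_bimodEmbedding hD hJr B
    exact ⟨q, r, i, j, I, J, P, φ, hW.isKernel hD hI, hW.isKernel hD hJ, hφ', hφ⟩

end Wood

end DoubleCategory

theorem mainTheorem2 {D : Type*} [DoubleCategory D] (hD : DoubleCategory.IsEquipment D) :
    DoubleCategory.IsExact D ↔ DoubleCategory.WoodAxiom5 D :=
  ⟨fun hE => hE.woodAxiom5 hD, fun hW => hW.isExact hD⟩
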